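/- Consider a deck of $n$ cards numbered $1,\dots,n$ and laid out in a row; identify it with a permutation $\sigma\in S_n$, where $\sigma_i$ is the number of the card in the $i$-th position from the left, so that $\sigma^{-1}_j$ is the position of card number $j$. The card-cyclic to random insertion shuffle removes and reinserts each of the $n$ cards exactly once, in the original left to right order of the cards; each removed card is reinserted so that it occupies a position chosen uniformly from the $n$ positions $1,\dots,n$, independently of the other choices. Let $p_n(\mathrm{id},\cdot)$ be the distribution on $S_n$ of the final deck when the initial deck is the identity. For $b\in[0,1]$ define $G_b:[0,1]\to[0,1]$ by $$ G_b(y)=\begin{cases} y\,e^{1-b}, & 0\le y\le 1-(1-b)e^{b},\\ e^{(1-y)e^{-b}}-(1-y)e^{1-b}, & 1-(1-b)e^{b}\le y\le 1.\end{cases} $$ Then $G_b$ is a bijection of $[0,1]$ onto itself. Let $(b_n)$ be a sequence such that $b_nn\in\{1,\dots,n\}$ for every $n\ge1$ and $\lim_{n\to\infty}b_n=b\in[0,1]$. Then, under $p_n(\mathrm{id},\cdot)$, the distribution of $\frac1n\sigma^{-1}_{b_nn}$ converges weakly as $n\to\infty$ to a probability measure which depends only on $b$, and the distribution function $F_b$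 of this measure satisfies $$ F_b(x)=\lim_{n\to\infty}p_n(\mathrm{id},\{\sigma^{-1}_{b_nn}\le xn\}),\qquad x\in[0,1], $$ and, on $[0,1]$, $F_b=G_b^{-1}$. -/

import Mathlib

open Filter Topology MeasureTheory Set

noncomputable section

/-- A deck of `n` cards is a permutation `σ` of `Fin n`: `σ i` is the card in position `i` from
the left. Positions and card numbers `1, …, n` are represented by `0, …, n - 1`.
`reinsert σ c k` is the deck obtained from `σ` by removing card `c` and reinserting it so that it
occupies position `k`, the relative order of all the other cards being unchanged: the new deck
sends `k` to `c`, and sends the `i`-th position different from `k` to the card which `σ` has in the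
`i`-th position different from the old position of `c`. -/
def reinsert : {n : ℕ} → Equiv.Perm (Fin n) → Fin n → Fin n → Equiv.Perm (Fin n)
  | 0, σ, _, _ => σ
  | _ + 1, σ, c, k => ((finSuccEquiv' k).trans (finSuccEquiv' (σ.symm c)).symm).trans σ

/-- The outcome of the card-cyclic to random insertion shuffle started at `σ` when the insertion
positions are given by `κ`: every card is removed and reinserted exactly once, in the original left
to right order `σ 0, σ 1, …, σ (n - 1)`, and the `i`-th of these cards is reinserted in position
`κ i` of the current deck. -/
def shuffleOutcome {n : ℕ} (σ : Equiv.Perm (Fin n)) (κ : Fin n → Fin n) : Equiv.Perm (Fin n) :=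
  (List.finRange n).foldl (fun τ i => reinsert τ (σ i) (κ i)) σ

/-- The transition law `p_n(σ, ·)` of the shuffle: the `n ^ n` choices of the insertion positions
are equally likely. -/
def shuffleLaw {n : ℕ} (σ : Equiv.Perm (Fin n)) : PMF (Equiv.Perm (Fin n)) :=
  haveI : Nonempty (Fin n → Fin n) := ⟨id⟩
  (PMF.uniformOfFintype (Fin n → Fin n)).map (shuffleOutcome σ)

/-- The position (in `{1, …, n}`) of the card with number `j ∈ {1, …, n}` in the deck `σ`
(`0` if there is no card with number `j`). -/
def cardPosition {n : ℕ} (σ : Equiv.Perm (Fin n)) (j : ℕ) : ℕ :=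
  if h : 1 ≤ j ∧ j ≤ n then (σ.symm ⟨j - 1, by omega⟩ : ℕ) + 1 else 0

/-- The distribution on `ℝ` of the position of card `j` divided by `n`, under `p_n(id, ·)`. -/
def rescaledPositionLaw (n j : ℕ) : ProbabilityMeasure ℝ :=
  ⟨((shuffleLaw (1 : Equiv.Perm (Fin n))).map (fun σ => (cardPosition σ j : ℝ) / n)).toMeasure,
    inferInstance⟩

/-- The probability `p_n(id, {σ : the position of card j is at most y})`. -/
def positionProb (n j : ℕ) (y : ℝ) : ℝ :=
  ((shuffleLaw (1 : Equiv.Perm (Fin n))).toOuterMeasure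
    {σ | (cardPosition σ j : ℝ) ≤ y}).toReal

/-- The function `G_b` (used on `[0, 1]`). -/
def G (b y : ℝ) : ℝ :=
  if y ≤ 1 - (1 - b) * Real.exp b then y * Real.exp (1 - b)
  else Real.exp ((1 - y) * Real.exp (-b)) - (1 - y) * Real.exp (1 - b)

end

/-! Follow card `J`, inserted at time `J ≈ bn` in a uniform position `k ≈ yn`. Reinsertions preserve
the relative order of the other cards, so the cards after `J` stay in increasing order until
processed. Hence there is a switching time: later cards removed before it lie to the left of `J`,
those removed from it on lie to the right (`deckAt_symm_lt_processed_iff`). In the left phase the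
distance of `J` from the right end is a birth process with rate proportional to its size; in the
right phase its position is one. On the scale `n` both concentrate in L² around capped exponentials
(`expect_sq_sub_le_of_birth`).

The card numbered about `sn` sits near `1 - (1 - s)e^b` at time `b`, so the switch occurs at `s = 1
- (1 - y)e^{-b}`, or at `b` if that is larger. Running the two phases gives exactly `G b y`
(`switchedLimit_switchTime`). The random switching time is not analysed directly: a path whose
deterministic switch is slightly too late bounds the position from below, one slightly too early
bounds it from above (`switchedPosition_le`, `le_switchedPosition`), and continuity in `s` closes
the gap.

So, given `y`, the rescaled position tends to `G b y` in probability. Since `y` is uniform, the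
limit law is the image of the uniform law under the increasing bijection `G b`, and its distribution
function is the inverse of `G b`. -/

open scoped BigOperators BoundedContinuousFunction

/-! ### Exact dynamics of the position of one card -/

/-- New position of a card at position `q` when a card to its left is moved to position `k`. -/
def stepLeft (q k : ℕ) : ℕ := if k < q then q else q - 1

/-- New position of a card at position `q` of `n` when a card to its right is moved to
position `k`. -/
def stepRight (n q k : ℕ) : ℕ := if k ≤ q ∧ q + 1 < n then q + 1 else q

theorem stepLeft_mono {p q : ℕ} (h : p ≤ q) (k : ℕ) : stepLeft p k ≤ stepLeft q k := by
  unfold stepLeft; split_ifs <;> omega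

theorem stepRight_mono (n : ℕ) {p q : ℕ} (h : p ≤ q) (k : ℕ) :
    stepRight n p k ≤ stepRight n q k := by
  unfold stepRight; split_ifs <;> omega

/-- With the monotonicity of both steps, this gives the pathwise comparison: replacing a left step
by a right step can only raise all later positions. -/
theorem stepLeft_le_stepRight (n q k : ℕ) : stepLeft q k ≤ stepRight n q k := by
  unfold stepLeft stepRight; split_ifs <;> omega

theorem reinsert_symm_self {n : ℕ} (σ : Equiv.Perm (Fin n)) (c k : Fin n) :
    (reinsert σ c k).symm c = k := by
  cases n with
  | zero => exact k.elim0
  | succ n => simp [reinsert]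

theorem reinsert_symm_of_ne {n : ℕ} (σ : Equiv.Perm (Fin n)) (c k d : Fin n) (h : d ≠ c) :
    ((reinsert σ c k).symm d : ℕ) =
      if (σ.symm c : ℕ) < σ.symm d then stepLeft (σ.symm d) k else stepRight n (σ.symm d) k := by
  cases n with
  | zero => exact k.elim0
  | succ n =>
    have hne : σ.symm d ≠ σ.symm c := fun e => h (σ.symm.injective e)
    -- `q` is the position of `d` in the deck from which `c` has been taken out.
    obtain ⟨q, hq⟩ := Fin.exists_succAbove_eq hne
    have : (reinsert σ c k).symm d = k.succAbove q := by
      simp [reinsert, ← hq]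
    rw [this, ← hq]
    unfold stepLeft stepRight
    simp only [Fin.succAbove, Fin.lt_def]
    split_ifs <;> simp_all <;> omega

theorem reinsert_symm_lt_iff {n : ℕ} (σ : Equiv.Perm (Fin n)) (c k d e : Fin n)
    (hd : d ≠ c) (he : e ≠ c) :
    ((reinsert σ c k).symm d : ℕ) < (reinsert σ c k).symm e ↔ (σ.symm d : ℕ) < σ.symm e := by
  have hd' : (σ.symm d : ℕ) ≠ σ.symm c := fun h => hd (σ.symm.injective (Fin.ext h))
  have he' : (σ.symm e : ℕ) ≠ σ.symm c := fun h => he (σ.symm.injective (Fin.ext h))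
  rw [reinsert_symm_of_ne σ c k d hd, reinsert_symm_of_ne σ c k e he]
  unfold stepLeft stepRight
  split_ifs <;> omega

/-- The insertion position used at time `m` (`0` past the last step). -/
def insertionAt {n : ℕ} (κ : Fin n → Fin n) (m : ℕ) : ℕ := if h : m < n then κ ⟨m, h⟩ else 0

/-- The deck after the first `m` steps of the shuffle started at the identity. -/
def deckAt {n : ℕ} (κ : Fin n → Fin n) : ℕ → Equiv.Perm (Fin n)
  | 0 => 1
  | m + 1 => if h : m < n then reinsert (deckAt κ m) ⟨m, h⟩ (κ ⟨m, h⟩) else deckAt κ m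

/-- The position evolving from `q` under `m` successive steps at the times `a, a + 1, …`. -/
def runSteps {n : ℕ} (step : ℕ → ℕ → ℕ) (κ : Fin n → Fin n) (a q : ℕ) : ℕ → ℕ
  | 0 => q
  | m + 1 => step (runSteps step κ a q m) (insertionAt κ (a + m))

theorem shuffleOutcome_one {n : ℕ} (κ : Fin n → Fin n) : shuffleOutcome 1 κ = deckAt κ n := by
  have key : ∀ m, m ≤ n → ((List.finRange n).take m).foldl
      (fun τ i => reinsert τ ((1 : Equiv.Perm (Fin n)) i) (κ i)) 1 = deckAt κ m := by
    intro m
    induction m with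
    | zero => intro _; simp [deckAt]
    | succ m ih =>
      intro hm
      have hm' : m < n := hm
      rw [List.take_add_one, List.foldl_append, ih hm'.le]
      simp [deckAt, hm']
  have := key n le_rfl
  rwa [List.take_of_length_le (by simp)] at this

theorem insertionAt_of_lt {n : ℕ} (κ : Fin n → Fin n) {m : ℕ} (h : m < n) :
    insertionAt κ m = κ ⟨m, h⟩ := by simp [insertionAt, h]

theorem deckAt_succ {n : ℕ} (κ : Fin n → Fin n) {m : ℕ} (h : m < n) :
    deckAt κ (m + 1) = reinsert (deckAt κ m) ⟨m, h⟩ (κ ⟨m, h⟩) := by simp [deckAt, h]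

theorem deckAt_symm_lt_of_unprocessed {n : ℕ} (κ : Fin n → Fin n) {m : ℕ} (d e : Fin n)
    (hd : m ≤ d) (hde : d < e) : ((deckAt κ m).symm d : ℕ) < (deckAt κ m).symm e := by
  induction m with
  | zero => exact hde
  | succ m ih =>
    have hm : m < n := by omega
    rw [deckAt_succ κ hm, reinsert_symm_lt_iff _ _ _ _ _ (by simp [Fin.ext_iff]; omega)
      (by simp [Fin.ext_iff]; omega)]
    exact ih (by omega)

/-- Every card removed while `c` waits is itself an unprocessed card preceding `c`, so only left
steps occur. -/
theorem deckAt_symm_unprocessed {n : ℕ} (κ : Fin n → Fin n) {m : ℕ} (c : Fin n) (hc : m ≤ c) :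
    ((deckAt κ m).symm c : ℕ) = runSteps stepLeft κ 0 c m := by
  induction m with
  | zero => rfl
  | succ m ih =>
    have hm : m < n := by omega
    have hlt : (⟨m, hm⟩ : Fin n) < c := hc
    rw [deckAt_succ κ hm, reinsert_symm_of_ne _ _ _ _ hlt.ne',
      if_pos (deckAt_symm_lt_of_unprocessed κ _ _ le_rfl hlt), ih (by omega), runSteps, zero_add,
      insertionAt_of_lt κ hm]

/-- The side of `J` on which `c` lies is decided when `J` is inserted, and is then frozen until `c`
is processed because neither card is picked up in between. At the insertion, a card `c` at position
`p` moves to `p - 1` if `p ≤ κ J` and stays at `p` otherwise; `p ≥ 1` because `J` was to its left.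
-/
theorem deckAt_symm_lt_processed_iff {n : ℕ} (κ : Fin n → Fin n) (J c : Fin n) (hJc : J < c)
    {m : ℕ} (hJm : J < m) (hmc : m ≤ c) :
    ((deckAt κ m).symm c : ℕ) < (deckAt κ m).symm J ↔ runSteps stepLeft κ 0 c J ≤ κ J := by
  induction m with
  | zero => omega
  | succ m ih =>
    have hm : m < n := by omega
    have hcm : c ≠ ⟨m, hm⟩ := by intro h; rw [Fin.ext_iff] at h; simp at h; omega
    rw [deckAt_succ κ hm]
    by_cases hJ : (J : ℕ) = m
    · subst hJ
      have hlt := deckAt_symm_lt_of_unprocessed κ J c le_rfl hJc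
      rw [reinsert_symm_self, reinsert_symm_of_ne _ _ _ _ hcm, if_pos hlt,
        ← deckAt_symm_unprocessed κ c (by omega)]
      simp only [Fin.eta] at *
      unfold stepLeft
      split_ifs <;> omega
    · rw [reinsert_symm_lt_iff _ _ _ _ _ hcm (by intro h; rw [Fin.ext_iff] at h; exact hJ h)]
      exact ih (by omega) (by omega)

theorem deckAt_symm_processed_succ {n : ℕ} (κ : Fin n → Fin n) (J : Fin n) {m : ℕ}
    (hJm : J < m) (hm : m < n) :
    ((deckAt κ (m + 1)).symm J : ℕ) =
      if ((deckAt κ m).symm ⟨m, hm⟩ : ℕ) < (deckAt κ m).symm J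
      then stepLeft ((deckAt κ m).symm J) (insertionAt κ m)
      else stepRight n ((deckAt κ m).symm J) (insertionAt κ m) := by
  rw [deckAt_succ κ hm, reinsert_symm_of_ne _ _ _ _ (by
    intro h; rw [Fin.ext_iff] at h; simp at h; omega), insertionAt_of_lt κ hm]

theorem deckAt_symm_just_processed {n : ℕ} (κ : Fin n → Fin n) (J : Fin n) :
    (deckAt κ (J + 1)).symm J = κ J := by
  rw [deckAt_succ κ J.isLt, reinsert_symm_self]

/-! ### Comparison with a deterministic switching time -/

/-- The final position of card `J`, inserted at position `k`, if before time `c` all later cards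
were to its left and from time `c` on all of them were to its right. -/
def switchedPosition {n : ℕ} (κ : Fin n → Fin n) (J c k : ℕ) : ℕ :=
  runSteps (stepRight n) κ c (runSteps stepLeft κ (J + 1) k (c - (J + 1))) (n - c)

/-- If card `c` is to the right of `J`, so are all cards after it, and the steps from time `c` on
are genuine right steps. Before `c` each genuine step is at least the left step. For `c = n` there
is no right phase and nothing to assume. -/
theorem switchedPosition_le {n : ℕ} (κ : Fin n → Fin n) (J : Fin n) (c : ℕ) (hJc : J < c)
    (hcn : c ≤ n) (h : c < n → (κ J : ℕ) < runSteps stepLeft κ 0 c J) :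
    switchedPosition κ J c (κ J) ≤ (deckAt κ n).symm J := by
  have h1 : ∀ m, J + 1 + m ≤ c →
      runSteps stepLeft κ (J + 1) (κ J) m ≤ (deckAt κ (J + 1 + m)).symm J := by
    intro m
    induction m with
    | zero => intro _; simp [runSteps, deckAt_symm_just_processed]
    | succ m ih =>
      intro hm
      rw [← add_assoc, deckAt_symm_processed_succ κ J (by omega) (by omega), runSteps]
      have := stepLeft_mono (ih (by omega)) (insertionAt κ (J + 1 + m))
      split_ifs
      · exact this
      · exact this.trans (stepLeft_le_stepRight _ _ _)
  have h2 : ∀ m, c + m ≤ n →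
      runSteps (stepRight n) κ c (runSteps stepLeft κ (J + 1) (κ J) (c - (J + 1))) m ≤
        (deckAt κ (c + m)).symm J := by
    intro m
    induction m with
    | zero =>
      intro _
      have := h1 (c - (J + 1)) (by omega)
      rw [show (J : ℕ) + 1 + (c - (J + 1)) = c by omega] at this
      simpa [runSteps] using this
    | succ m ih =>
      intro hm
      rw [← add_assoc, deckAt_symm_processed_succ κ J (by omega) (by omega), runSteps]
      have hnot : ¬ ((deckAt κ (c + m)).symm ⟨c + m, hm⟩ : ℕ) < (deckAt κ (c + m)).symm J := by
        rw [deckAt_symm_lt_processed_iff κ J ⟨c + m, hm⟩ (by rw [Fin.lt_def]; simp; omega)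
          (m := c + m) (by omega) le_rfl]
        have hc := h (by omega)
        rw [← deckAt_symm_unprocessed κ ⟨c + m, hm⟩ (by simp; omega), not_le]
        rw [← deckAt_symm_unprocessed κ (⟨c, by omega⟩ : Fin n) (by simp; omega)] at hc
        rcases Nat.eq_zero_or_pos m with rfl | hm0
        · exact hc
        · exact hc.trans (deckAt_symm_lt_of_unprocessed κ _ _ (by simp; omega)
            (by rw [Fin.lt_def]; simp; omega))
      rw [if_neg hnot]
      exact stepRight_mono n (ih (by omega)) _
  have := h2 (n - c) (by omega)
  rwa [show c + (n - c) = n by omega] at this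

/-- Mirror image: if card `c` is to the left of `J`, so are all the cards between them, and the
steps before `c` are genuine left steps; afterwards right steps dominate. For `c = J + 1` the left
phase is empty, so the bound is unconditional. -/
theorem le_switchedPosition {n : ℕ} (κ : Fin n → Fin n) (J : Fin n) (c : ℕ) (hJc : J < c)
    (hcn : c ≤ n) (h : J + 1 < c → c < n ∧ runSteps stepLeft κ 0 c J ≤ κ J) :
    ((deckAt κ n).symm J : ℕ) ≤ switchedPosition κ J c (κ J) := by
  have h1 : ∀ m, J + 1 + m ≤ c →
      (deckAt κ (J + 1 + m)).symm J ≤ runSteps stepLeft κ (J + 1) (κ J) m := by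
    intro m
    induction m with
    | zero => intro _; simp [runSteps, deckAt_symm_just_processed]
    | succ m ih =>
      intro hm
      obtain ⟨hcn', hc⟩ := h (by omega)
      rw [← add_assoc, deckAt_symm_processed_succ κ J (by omega) (by omega), runSteps]
      have hlt : ((deckAt κ (J + 1 + m)).symm ⟨J + 1 + m, by omega⟩ : ℕ) <
          (deckAt κ (J + 1 + m)).symm J := by
        refine (deckAt_symm_lt_of_unprocessed κ _ ⟨c, hcn'⟩ (by simp)
          (by rw [Fin.lt_def]; simp; omega)).trans ?_
        rw [deckAt_symm_lt_processed_iff κ J ⟨c, hcn'⟩ (by rw [Fin.lt_def]; simp; omega)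
          (by omega) (by simp; omega)]
        exact hc
      rw [if_pos hlt]
      exact stepLeft_mono (ih (by omega)) _
  have h2 : ∀ m, c + m ≤ n → (deckAt κ (c + m)).symm J ≤
      runSteps (stepRight n) κ c (runSteps stepLeft κ (J + 1) (κ J) (c - (J + 1))) m := by
    intro m
    induction m with
    | zero =>
      intro _
      have := h1 (c - (J + 1)) (by omega)
      rw [show (J : ℕ) + 1 + (c - (J + 1)) = c by omega] at this
      simpa [runSteps] using this
    | succ m ih =>
      intro hm
      rw [← add_assoc, deckAt_symm_processed_succ κ J (by omega) (by omega), runSteps]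
      have := stepRight_mono n (ih (by omega)) (insertionAt κ (c + m))
      split_ifs
      · exact (stepLeft_le_stepRight _ _ _).trans this
      · exact this
  have := h2 (n - c) (by omega)
  rwa [show c + (n - c) = n by omega] at this

/-! ### Second moment estimates for capped birth processes -/

/-- This is the form in which independence is used: a run reads only the insertion positions of its
own time window. -/
theorem runSteps_update {n : ℕ} (step : ℕ → ℕ → ℕ) (κ : Fin n → Fin n) (a q m : ℕ) (i k : Fin n)
    (h : (i : ℕ) < a ∨ a + m ≤ i) :
    runSteps step (Function.update κ i k) a q m = runSteps step κ a q m := by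
  induction m with
  | zero => rfl
  | succ m ih =>
    rw [runSteps, runSteps, ih (by omega)]
    congr 1
    unfold insertionAt
    split_ifs with hm
    · rw [Function.update_of_ne]
      intro e
      rw [Fin.ext_iff] at e
      simp at e
      omega
    · rfl

theorem insertionAt_update_self {n : ℕ} (κ : Fin n → Fin n) {m : ℕ} (h : m < n) (k : Fin n) :
    insertionAt (Function.update κ ⟨m, h⟩ k) m = k := by
  simp [insertionAt, h]

/-- Resampling one coordinate does not change an average over all functions. -/
theorem expect_update {n : ℕ} (i : Fin n) (g : (Fin n → Fin n) → ℝ) :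
    𝔼 κ, g κ = 𝔼 κ, 𝔼 k, g (Function.update κ i k) := by
  have hn : (n : ℝ) ≠ 0 := by
    exact_mod_cast (i.pos).ne'
  -- The involution exchanging the fresh value with the old coordinate.
  let e : ((Fin n → Fin n) × Fin n) ≃ ((Fin n → Fin n) × Fin n) :=
    { toFun := fun p => (Function.update p.1 i p.2, p.1 i)
      invFun := fun p => (Function.update p.1 i p.2, p.1 i)
      left_inv := fun p => by simp
      right_inv := fun p => by simp }
  have h1 : ∑ κ, ∑ k, g (Function.update κ i k) = ∑ κ : Fin n → Fin n, ∑ k : Fin n, g κ := by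
    rw [← Fintype.sum_prod_type', ← Fintype.sum_prod_type']
    exact Equiv.sum_comp e (fun p : (Fin n → Fin n) × Fin n => g p.1)
  simp only [Fintype.expect_eq_sum_div_card] at *
  rw [← Finset.sum_div, h1]
  simp [← Finset.mul_sum]
  field_simp

/-- One step of the birth process: the mean is multiplied by `1 + 1/n`, and the variance added is at
most `x/n ≤ 1`. Since values stay at most `n`, capping the target at `n` only brings it closer. -/
theorem sum_sq_sub_min_le {n : ℕ} (hn : 0 < n) {x a : ℝ} (hxn : x ≤ n)
    (ha0 : 0 ≤ a) (han : a ≤ n) (f : Fin n → ℝ)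
    (h : (x = n ∧ ∀ k, f k = n) ∨
      ((∀ k, f k = x ∨ f k = x + 1) ∧ (∀ k, f k ≤ n) ∧ ∑ k, f k = (n + 1) * x)) :
    𝔼 k, (f k - min (n : ℝ) (a * (1 + 1 / n))) ^ 2 ≤ (1 + 1 / (n : ℝ)) ^ 2 * (x - a) ^ 2 + 1 := by
  have hn' : (0 : ℝ) < n := by exact_mod_cast hn
  have : Nonempty (Fin n) := ⟨⟨0, hn⟩⟩
  have hq : (1 : ℝ) ≤ 1 + 1 / n := by simp
  rcases h with ⟨hx, hf⟩ | ⟨hf, hfn, hsum⟩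
  · simp only [hf]
    rw [Finset.expect_const Finset.univ_nonempty, hx]
    have h1 : a ≤ min (n : ℝ) (a * (1 + 1 / n)) := le_min han (le_mul_of_one_le_right ha0 hq)
    have h2 : min (n : ℝ) (a * (1 + 1 / n)) ≤ n := min_le_left _ _
    have h3 : ((n : ℝ) - min (n : ℝ) (a * (1 + 1 / n))) ^ 2 ≤ (n - a) ^ 2 := by
      apply pow_le_pow_left₀ <;> linarith
    have h4 : (n - a) ^ 2 ≤ (1 + 1 / (n : ℝ)) ^ 2 * (n - a) ^ 2 :=
      le_mul_of_one_le_left (sq_nonneg _) (one_le_pow₀ hq)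
    linarith
  · set A := a * (1 + 1 / n) with hA
    -- As `f k` is `x` or `x + 1`, its square is `(2x + 1) f k - x(x + 1)`. The bound is thus affine
    -- in `f k`, and the sum of the `f k` determines its average.
    have h1 : ∀ k, (f k - min (n : ℝ) A) ^ 2 ≤ (2 * x + 1 - 2 * A) * f k + (A ^ 2 - x ^ 2 - x) := by
      intro k
      have e : (f k - A) ^ 2 = (2 * x + 1 - 2 * A) * f k + (A ^ 2 - x ^ 2 - x) := by
        rcases hf k with h | h <;> rw [h] <;> ring
      rw [← e]
      rcases le_total (n : ℝ) A with h | h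
      · rw [min_eq_left h, sq_le_sq, abs_of_nonpos (by linarith [hfn k]),
          abs_of_nonpos (by linarith [hfn k])]
        linarith
      · rw [min_eq_right h]
    rw [Fintype.expect_eq_sum_div_card, Fintype.card_fin, div_le_iff₀ hn']
    refine (Finset.sum_le_sum fun k _ => h1 k).trans ?_
    rw [Finset.sum_add_distrib, ← Finset.mul_sum, hsum]
    simp only [Finset.sum_const, Finset.card_univ, Fintype.card_fin, nsmul_eq_mul]
    have e : (2 * x + 1 - 2 * A) * ((n + 1) * x) + n * (A ^ 2 - x ^ 2 - x) =
        (1 + 1 / (n : ℝ)) ^ 2 * (x - a) ^ 2 * n + x - x ^ 2 / n := by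
      rw [hA]; field_simp; ring
    rw [e, add_mul]
    have : 0 ≤ x ^ 2 / n := by positivity
    linarith

/-- The capped birth process on `{0, …, n}`: from `x < n` a step leads to `x + 1` with probability
`x / n`. -/
theorem expect_sq_sub_le_of_birth {n : ℕ} (hn : 0 < n) (a : ℕ) {M : ℕ} (hM : a + M ≤ n)
    (X : ℕ → (Fin n → Fin n) → ℝ) (x : ℝ) (hx0 : 0 ≤ x) (hxn : x ≤ n)
    (hXn : ∀ m κ, X m κ ≤ n)
    (hstep : ∀ m (hm : a + m < n) κ,
      (X m κ = n ∧ ∀ k, X (m + 1) (Function.update κ ⟨a + m, hm⟩ k) = n) ∨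
      ((∀ k, X (m + 1) (Function.update κ ⟨a + m, hm⟩ k) = X m κ ∨
        X (m + 1) (Function.update κ ⟨a + m, hm⟩ k) = X m κ + 1) ∧
        ∑ k, X (m + 1) (Function.update κ ⟨a + m, hm⟩ k) = (n + 1) * X m κ)) :
    𝔼 κ, (X M κ - min (n : ℝ) (x * (1 + 1 / n) ^ M)) ^ 2 ≤
      (1 + 1 / (n : ℝ)) ^ (2 * M) * (𝔼 κ, (X 0 κ - x) ^ 2 + M) := by
  have hn' : (0 : ℝ) < n := by exact_mod_cast hn
  have : Nonempty (Fin n) := ⟨⟨0, hn⟩⟩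
  have hq : (1 : ℝ) ≤ 1 + 1 / n := by simp
  induction M with
  | zero => simp [min_eq_right hxn]
  | succ M ih =>
    have hm : a + M < n := hM
    have hb0 : 0 ≤ min (n : ℝ) (x * (1 + 1 / n) ^ M) := by positivity
    have hbn : min (n : ℝ) (x * (1 + 1 / n) ^ M) ≤ n := min_le_left _ _
    -- Capping at every step agrees with capping once at the end, because the factor `1 + 1/n` is at
    -- least `1`.
    have hrec : min (n : ℝ) (x * (1 + 1 / n) ^ (M + 1)) =
        min (n : ℝ) (min (n : ℝ) (x * (1 + 1 / n) ^ M) * (1 + 1 / n)) := by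
      rw [min_mul_of_nonneg _ _ (by positivity), pow_succ, mul_assoc, ← min_assoc,
        min_eq_left (a := (n : ℝ)) (le_mul_of_one_le_right hn'.le hq)]
    rw [expect_update ⟨a + M, hm⟩, hrec]
    have h1 : ∀ κ : Fin n → Fin n, 𝔼 k, (X (M + 1) (Function.update κ ⟨a + M, hm⟩ k) -
        min (n : ℝ) (min (n : ℝ) (x * (1 + 1 / n) ^ M) * (1 + 1 / n))) ^ 2 ≤
        (1 + 1 / (n : ℝ)) ^ 2 * (X M κ - min (n : ℝ) (x * (1 + 1 / n) ^ M)) ^ 2 + 1 := by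
      intro κ
      refine sum_sq_sub_min_le hn (hXn M κ) hb0 hbn _ ?_
      rcases hstep M hm κ with h | ⟨h, h'⟩
      · exact Or.inl h
      · exact Or.inr ⟨h, fun k => hXn _ _, h'⟩
    refine (Finset.expect_le_expect fun κ _ => h1 κ).trans ?_
    rw [Finset.expect_add_distrib, ← Finset.mul_expect, Finset.expect_const Finset.univ_nonempty]
    have h2 : (1 : ℝ) ≤ (1 + 1 / (n : ℝ)) ^ (2 * (M + 1)) := one_le_pow₀ hq
    have h3 := mul_le_mul_of_nonneg_left (ih hm.le) (sq_nonneg (1 + 1 / (n : ℝ)))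
    have e : (1 + 1 / (n : ℝ)) ^ (2 * (M + 1)) =
        (1 + 1 / (n : ℝ)) ^ 2 * (1 + 1 / (n : ℝ)) ^ (2 * M) := by ring
    rw [e] at h2 ⊢
    push_cast
    nlinarith

theorem sum_fin_boole_lt {n q : ℕ} (hq : q ≤ n) :
    ∑ k : Fin n, (if (k : ℕ) < q then (1 : ℝ) else 0) = q := by
  rw [Fin.sum_univ_eq_sum_range (fun k => if k < q then (1 : ℝ) else 0) n, Finset.sum_boole]
  congr 1
  rw [show (Finset.range n).filter (fun k => k < q) = Finset.range q by
    ext k; simp; omega, Finset.card_range]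

theorem stepLeft_lt {n q k : ℕ} (h : q < n) : stepLeft q k < n := by
  unfold stepLeft; split_ifs <;> omega

theorem stepRight_lt {n q k : ℕ} (h : q < n) : stepRight n q k < n := by
  unfold stepRight; split_ifs <;> omega

theorem runSteps_lt {n : ℕ} (step : ℕ → ℕ → ℕ) (hstep : ∀ q k, q < n → step q k < n)
    (κ : Fin n → Fin n) {a q : ℕ} (hq : q < n) (m : ℕ) : runSteps step κ a q m < n := by
  induction m with
  | zero => exact hq
  | succ m ih => exact hstep _ _ ih

theorem runSteps_succ_update {n : ℕ} (step : ℕ → ℕ → ℕ) (a : ℕ) (q : (Fin n → Fin n) → ℕ)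
    (hq : ∀ κ (i : Fin n), a ≤ i → ∀ k, q (Function.update κ i k) = q κ)
    (κ : Fin n → Fin n) {m : ℕ} (hm : a + m < n) (k : Fin n) :
    runSteps step (Function.update κ ⟨a + m, hm⟩ k) a (q (Function.update κ ⟨a + m, hm⟩ k))
      (m + 1) = step (runSteps step κ a (q κ) m) k := by
  rw [runSteps, insertionAt_update_self, hq _ _ (by simp), runSteps_update _ _ _ _ _ _ _ (by simp)]

/-- At position `p` a left step raises `n - p` by one exactly when `k ≥ p`, hence with probability
`(n - p)/n`. Truncated subtraction makes `p = 0` absorbing, which is the cap. -/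
theorem expect_sq_sub_le_of_left {n : ℕ} (hn : 0 < n) (a : ℕ) {M : ℕ} (hM : a + M ≤ n)
    (q : (Fin n → Fin n) → ℕ) (hqn : ∀ κ, q κ < n)
    (hq : ∀ κ (i : Fin n), a ≤ i → ∀ k, q (Function.update κ i k) = q κ)
    (x : ℝ) (hx0 : 0 ≤ x) (hxn : x ≤ n) :
    𝔼 κ, ((n : ℝ) - runSteps stepLeft κ a (q κ) M - min (n : ℝ) (x * (1 + 1 / n) ^ M)) ^ 2 ≤
      (1 + 1 / (n : ℝ)) ^ (2 * M) * (𝔼 κ, ((n : ℝ) - q κ - x) ^ 2 + M) := by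
  have hlt : ∀ m κ, runSteps stepLeft κ a (q κ) m < n := fun m κ =>
    runSteps_lt _ (fun _ _ h => stepLeft_lt h) κ (hqn κ) m
  refine expect_sq_sub_le_of_birth hn a hM
    (fun m κ => (n : ℝ) - runSteps stepLeft κ a (q κ) m) x hx0 hxn ?_ ?_
  · intro m κ
    have : (0 : ℝ) ≤ runSteps stepLeft κ a (q κ) m := by positivity
    linarith
  · intro m hm κ
    simp only [runSteps_succ_update stepLeft a q hq κ hm]
    have hp := hlt m κ
    generalize runSteps stepLeft κ a (q κ) m = p at hp
    rcases Nat.eq_zero_or_pos p with rfl | hp0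
    · left
      simp [stepLeft]
    · right
      have hs : ∀ k : Fin n, (n : ℝ) - (stepLeft p k : ℕ) =
          (n - p + 1) - (if (k : ℕ) < p then 1 else 0) := by
        intro k
        unfold stepLeft
        split_ifs
        · ring
        · rw [Nat.cast_pred hp0]; ring
      simp only [hs]
      refine ⟨fun k => ?_, ?_⟩
      · split_ifs
        · left; ring
        · right; ring
      · rw [Finset.sum_sub_distrib, sum_fin_boole_lt hp.le]
        simp
        ring

/-- A right step raises `p + 1` by one exactly when `k ≤ p`, hence with probability `(p + 1)/n`; the
shift by one makes this exact. The guard `q + 1 < n` in `stepRight` provides the cap. -/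
theorem expect_sq_sub_le_of_right {n : ℕ} (hn : 0 < n) (a : ℕ) {M : ℕ} (hM : a + M ≤ n)
    (q : (Fin n → Fin n) → ℕ) (hqn : ∀ κ, q κ < n)
    (hq : ∀ κ (i : Fin n), a ≤ i → ∀ k, q (Function.update κ i k) = q κ)
    (x : ℝ) (hx0 : 0 ≤ x) (hxn : x ≤ n) :
    𝔼 κ, ((runSteps (stepRight n) κ a (q κ) M : ℝ) + 1 - min (n : ℝ) (x * (1 + 1 / n) ^ M)) ^ 2 ≤
      (1 + 1 / (n : ℝ)) ^ (2 * M) * (𝔼 κ, ((q κ : ℝ) + 1 - x) ^ 2 + M) := by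
  have hlt : ∀ m κ, runSteps (stepRight n) κ a (q κ) m < n := fun m κ =>
    runSteps_lt _ (fun _ _ h => stepRight_lt h) κ (hqn κ) m
  refine expect_sq_sub_le_of_birth hn a hM
    (fun m κ => (runSteps (stepRight n) κ a (q κ) m : ℝ) + 1) x hx0 hxn ?_ ?_
  · intro m κ
    exact_mod_cast hlt m κ
  · intro m hm κ
    simp only [runSteps_succ_update (stepRight n) a q hq κ hm]
    have hp := hlt m κ
    generalize runSteps (stepRight n) κ a (q κ) m = p at hp
    rcases Nat.lt_or_ge (p + 1) n with hp1 | hp1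
    · right
      have hs : ∀ k : Fin n, ((stepRight n p k : ℕ) : ℝ) + 1 =
          (p + 1) + (if (k : ℕ) < p + 1 then 1 else 0) := by
        intro k
        unfold stepRight
        by_cases h : (k : ℕ) ≤ p
        · rw [if_pos ⟨h, hp1⟩, if_pos (by omega)]; push_cast; ring
        · rw [if_neg (fun h' => h h'.1), if_neg (by omega)]; ring
      simp only [hs]
      refine ⟨fun k => ?_, ?_⟩
      · split_ifs
        · right; ring
        · left; ring
      · rw [Finset.sum_add_distrib, sum_fin_boole_lt hp1.le]
        simp
        ring
    · left
      have : p + 1 = n := by omega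
      refine ⟨by exact_mod_cast this, fun k => ?_⟩
      rw [stepRight, if_neg (by omega)]
      exact_mod_cast this

/-! ### The function `G b` and the limit law -/

/-- The two branches are one expression `exp (1 - s) - (1 - y) exp (1 - b)`, where `s` is the
switching time; the `min` reflects that `s ≥ b`. -/
theorem G_eq (b y : ℝ) :
    G b y = Real.exp (min ((1 - y) * Real.exp (-b)) (1 - b)) - (1 - y) * Real.exp (1 - b) := by
  have hinv : Real.exp b * Real.exp (-b) = 1 := by rw [← Real.exp_add]; simp
  have hp := Real.exp_pos b
  have hp' := Real.exp_pos (-b)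
  unfold G
  split_ifs with h
  · rw [min_eq_right]
    · ring
    · have := mul_le_mul_of_nonneg_right (show (1 - b) * Real.exp b ≤ 1 - y by linarith) hp'.le
      rwa [mul_assoc, hinv, mul_one] at this
  · rw [min_eq_left]
    have := mul_le_mul_of_nonneg_right (show 1 - y ≤ (1 - b) * Real.exp b by linarith) hp'.le
    rwa [mul_assoc, hinv, mul_one] at this

theorem continuous_G (b : ℝ) : Continuous (G b) := by
  rw [show G b = _ from funext (G_eq b)]
  fun_prop

theorem G_zero (b : ℝ) : G b 0 = 0 := by
  rw [G_eq, min_eq_right]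
  · simp
  · have := Real.add_one_le_exp (-b)
    linarith

theorem G_one {b : ℝ} (hb : b ≤ 1) : G b 1 = 1 := by
  rw [G_eq, min_eq_left (by simpa using hb)]
  simp

/-- As `y` grows, the exponent `w` decreases at rate at most `exp (-b) ≤ 1`, and `exp` has slope at
most `exp (1 - b)` on the range of `w`. The loss is therefore at most the linear gain; strict
convexity of `exp` makes the inequality strict. -/
theorem strictMono_G {b : ℝ} (hb : 0 ≤ b) : StrictMono (G b) := by
  intro y y' hy
  rw [G_eq, G_eq]
  set w := min ((1 - y) * Real.exp (-b)) (1 - b) with hw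
  set w' := min ((1 - y') * Real.exp (-b)) (1 - b) with hw'
  have hpb := Real.exp_pos (-b)
  have hb1 : Real.exp (-b) ≤ 1 := Real.exp_le_one_iff.2 (by linarith)
  have hw1 : w ≤ 1 - b := min_le_right _ _
  have hle : w - w' ≤ (y' - y) * Real.exp (-b) := by
    rcases min_choice ((1 - y') * Real.exp (-b)) (1 - b) with h | h
    · have : w ≤ (1 - y) * Real.exp (-b) := min_le_left _ _
      rw [hw', h]; linarith
    · have : 0 ≤ (y' - y) * Real.exp (-b) := mul_nonneg (by linarith) hpb.le
      rw [hw', h]; linarith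
  have hle' : w - w' ≤ y' - y := hle.trans (mul_le_of_le_one_right (by linarith) hb1)
  have hmono : w' ≤ w := min_le_min_right _ (mul_le_mul_of_nonneg_right (by linarith) hpb.le)
  have hpw : Real.exp w ≤ Real.exp (1 - b) := Real.exp_le_exp.2 hw1
  have hp1 := Real.exp_pos (1 - b)
  have hpw0 := Real.exp_pos w
  suffices Real.exp w - Real.exp w' < (y' - y) * Real.exp (1 - b) by linarith
  rcases hmono.eq_or_lt with h | h
  · rw [h, sub_self]
    exact mul_pos (by linarith) hp1
  · have h1 : w' - w + 1 < Real.exp (w' - w) := Real.add_one_lt_exp (by linarith)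
    have h2 : Real.exp w' = Real.exp w * Real.exp (w' - w) := by rw [← Real.exp_add]; ring_nf
    have h3 := mul_lt_mul_of_pos_left h1 hpw0
    have h4 : (w - w') * Real.exp w ≤ (y' - y) * Real.exp (1 - b) :=
      mul_le_mul hle' hpw hpw0.le (by linarith)
    rw [h2]
    linarith

theorem bijOn_G {b : ℝ} (hb : b ∈ Icc (0 : ℝ) 1) : BijOn (G b) (Icc 0 1) (Icc 0 1) := by
  refine ⟨fun y hy => ?_, (strictMono_G hb.1).injective.injOn, ?_⟩
  · have hm := (strictMono_G hb.1).monotone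
    exact ⟨by simpa [G_zero] using hm hy.1, by simpa [G_one hb.2] using hm hy.2⟩
  · have := intermediate_value_Icc (zero_le_one (α := ℝ)) (continuous_G b).continuousOn
    rwa [G_zero, G_one hb.2] at this

/-- The image of the uniform distribution on `[0, 1]` under `G b`. -/
noncomputable def limitLaw (b : ℝ) : ProbabilityMeasure ℝ :=
  ⟨(volume.restrict (Icc (0 : ℝ) 1)).map (G b), by
    have : IsProbabilityMeasure (volume.restrict (Icc (0 : ℝ) 1)) := ⟨by simp⟩
    exact Measure.isProbabilityMeasure_map (continuous_G b).aemeasurable⟩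

theorem integral_limitLaw (b : ℝ) (φ : ℝ → ℝ) (hφ : Continuous φ) :
    ∫ x, φ x ∂(limitLaw b : Measure ℝ) = ∫ y in Icc (0 : ℝ) 1, φ (G b y) :=
  integral_map (continuous_G b).aemeasurable hφ.aestronglyMeasurable

theorem cdf_limitLaw_G {b : ℝ} (hb : 0 ≤ b) {y : ℝ} (hy : y ∈ Icc (0 : ℝ) 1) :
    ProbabilityTheory.cdf (limitLaw b : Measure ℝ) (G b y) = y := by
  rw [ProbabilityTheory.cdf_eq_real]
  change ((volume.restrict (Icc (0 : ℝ) 1)).map (G b)).real (Iic (G b y)) = y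
  rw [map_measureReal_apply (continuous_G b).measurable measurableSet_Iic,
    measureReal_restrict_apply ((continuous_G b).measurable measurableSet_Iic)]
  have : G b ⁻¹' Iic (G b y) ∩ Icc 0 1 = Icc 0 y := by
    ext z
    simp only [mem_inter_iff, mem_preimage, mem_Iic, (strictMono_G hb).le_iff_le, mem_Icc]
    exact ⟨fun h => ⟨h.2.1, h.1⟩, fun h => ⟨h.2, h.1, h.2.trans hy.2⟩⟩
  rw [this]
  simp [Measure.real, hy.1]

theorem limitLaw_singleton {b : ℝ} (hb : 0 ≤ b) (x : ℝ) : (limitLaw b : Measure ℝ) {x} = 0 := by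
  change ((volume.restrict (Icc (0 : ℝ) 1)).map (G b)) {x} = 0
  rw [Measure.map_apply (continuous_G b).measurable (measurableSet_singleton x)]
  refine Measure.absolutelyContinuous_of_le Measure.restrict_le_self ?_
  exact ((subsingleton_singleton).preimage (strictMono_G hb).injective).measure_zero _

theorem invOn_cdf_limitLaw {b : ℝ} (hb : b ∈ Icc (0 : ℝ) 1) :
    InvOn (ProbabilityTheory.cdf (limitLaw b : Measure ℝ)) (G b) (Icc 0 1) (Icc 0 1) := by
  have hl : LeftInvOn (ProbabilityTheory.cdf (limitLaw b : Measure ℝ)) (G b) (Icc 0 1) :=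
    fun y hy => cdf_limitLaw_G hb.1 hy
  refine ⟨hl, fun x hx => ?_⟩
  obtain ⟨y, hy, rfl⟩ := (bijOn_G hb).surjOn hx
  rw [hl hy]

/-! ### Scaling limits of the two phases -/

/-- `X n / n` tends to `x` in `L²`, the insertion positions being uniform. -/
def TendstoScaledL2 (X : ∀ n : ℕ, (Fin n → Fin n) → ℝ) (x : ℝ) : Prop :=
  Tendsto (fun n : ℕ => 𝔼 κ : Fin n → Fin n, (X n κ / n - x) ^ 2) atTop (𝓝 0)

theorem nonempty_fin_fun (n : ℕ) : Nonempty (Fin n → Fin n) := ⟨id⟩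

theorem expect_fun_const {n : ℕ} (c : ℝ) : 𝔼 _κ : Fin n → Fin n, c = c :=
  have := nonempty_fin_fun n
  Finset.expect_const Finset.univ_nonempty c

theorem expect_sq_nonneg {n : ℕ} (f : (Fin n → Fin n) → ℝ) : 0 ≤ 𝔼 κ, f κ ^ 2 :=
  Finset.expect_nonneg fun _ _ => sq_nonneg _

theorem TendstoScaledL2.of_abs_le {X X' : ∀ n : ℕ, (Fin n → Fin n) → ℝ} {x x' : ℝ}
    (h : TendstoScaledL2 X x) (r : ℕ → ℝ) (hr : Tendsto r atTop (𝓝 0))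
    (hle : ∀ᶠ n : ℕ in atTop, ∀ κ, |X' n κ / n - x'| ≤ |X n κ / n - x| + r n) :
    TendstoScaledL2 X' x' := by
  have hlim : Tendsto (fun n : ℕ => 2 * 𝔼 κ : Fin n → Fin n, (X n κ / n - x) ^ 2 + 2 * r n ^ 2)
      atTop (𝓝 0) := by
    simpa using (h.const_mul 2).add ((hr.pow 2).const_mul 2)
  refine tendsto_of_tendsto_of_tendsto_of_le_of_le' tendsto_const_nhds hlim
    (Eventually.of_forall fun n => expect_sq_nonneg _) ?_
  filter_upwards [hle] with n hn
  rw [Finset.mul_expect, ← expect_fun_const (n := n) (2 * r n ^ 2), ← Finset.expect_add_distrib]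
  refine Finset.expect_le_expect fun κ _ => ?_
  have h1 := hn κ
  have h2 := sq_abs (X n κ / n - x)
  rw [← sq_abs (X' n κ / n - x')]
  have h3 : |X' n κ / n - x'| ^ 2 ≤ (|X n κ / n - x| + r n) ^ 2 :=
    pow_le_pow_left₀ (abs_nonneg _) h1 2
  nlinarith [sq_nonneg (|X n κ / n - x| - r n)]

theorem TendstoScaledL2.affine {X X' : ∀ n : ℕ, (Fin n → Fin n) → ℝ} {x : ℝ}
    (h : TendstoScaledL2 X x) {s : ℝ} (hs : |s| = 1) (d : ℕ → ℝ) {e : ℝ}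
    (hd : Tendsto (fun n : ℕ => d n / n) atTop (𝓝 e))
    (hX : ∀ᶠ n : ℕ in atTop, ∀ κ, X' n κ = s * X n κ + d n) :
    TendstoScaledL2 X' (s * x + e) := by
  refine h.of_abs_le (fun n => |d n / n - e|) ?_ ?_
  · simpa using (hd.sub_const e).abs
  · filter_upwards [hX] with n hn κ
    rw [hn κ]
    calc |(s * X n κ + d n) / n - (s * x + e)| = |s * (X n κ / n - x) + (d n / n - e)| := by
          ring_nf
      _ ≤ |s * (X n κ / n - x)| + |d n / n - e| := abs_add_le _ _
      _ = _ := by rw [abs_mul, hs, one_mul]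

theorem tendstoScaledL2_const (d : ℕ → ℝ) {e : ℝ}
    (hd : Tendsto (fun n : ℕ => d n / n) atTop (𝓝 e)) :
    TendstoScaledL2 (fun n _ => d n) e := by
  unfold TendstoScaledL2
  simp only [expect_fun_const]
  simpa using (hd.sub_const e).pow 2

theorem tendsto_one_add_inv_pow {m : ℕ → ℕ} {t : ℝ}
    (hm : Tendsto (fun n : ℕ => (m n : ℝ) / n) atTop (𝓝 t)) :
    Tendsto (fun n : ℕ => (1 + 1 / (n : ℝ)) ^ m n) atTop (𝓝 (Real.exp t)) := by
  have h1 : Tendsto (fun n : ℕ => (n : ℝ) * Real.log (1 + 1 / n)) atTop (𝓝 1) :=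
    (Real.tendsto_mul_log_one_add_div_atTop 1).comp tendsto_natCast_atTop_atTop
  have h2 := (Real.continuous_exp.tendsto _).comp (hm.mul h1)
  rw [mul_one] at h2
  refine h2.congr' ?_
  filter_upwards [eventually_gt_atTop 0] with n hn
  have hn' : (0 : ℝ) < n := by exact_mod_cast hn
  have hp : (0 : ℝ) < 1 + 1 / n := by positivity
  simp only [Function.comp]
  rw [← Real.exp_log (pow_pos hp (m n)), Real.log_pow]
  congr 1
  field_simp

theorem one_add_inv_pow_le {n m : ℕ} (hn : 0 < n) (hm : m ≤ n) :
    (1 + 1 / (n : ℝ)) ^ (2 * m) ≤ Real.exp 2 := by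
  have hn' : (0 : ℝ) < n := by exact_mod_cast hn
  have h1 : 1 + 1 / (n : ℝ) ≤ Real.exp (1 / n) := by
    have := Real.add_one_le_exp (1 / (n : ℝ)); linarith
  refine (pow_le_pow_left₀ (by positivity) h1 _).trans ?_
  rw [← Real.exp_nat_mul, Real.exp_le_exp]
  have : (m : ℝ) ≤ n := by exact_mod_cast hm
  push_cast
  rw [mul_one_div, div_le_iff₀ hn']
  linarith

/-- After division by `n²` the accumulated variance, at most `n`, contributes `1/n`, while the
growth factor stays below `exp 2`. -/
theorem tendstoScaledL2_of_birth {X Y : ∀ n : ℕ, (Fin n → Fin n) → ℝ} {x t : ℝ}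
    (h : TendstoScaledL2 X x) {m : ℕ → ℕ}
    (hm : Tendsto (fun n : ℕ => (m n : ℝ) / n) atTop (𝓝 t))
    (hY : ∀ᶠ n : ℕ in atTop, m n ≤ n ∧
      𝔼 κ, (Y n κ - min (n : ℝ) (n * x * (1 + 1 / n) ^ m n)) ^ 2 ≤
        (1 + 1 / (n : ℝ)) ^ (2 * m n) * (𝔼 κ, (X n κ - n * x) ^ 2 + m n)) :
    TendstoScaledL2 Y (min 1 (x * Real.exp t)) := by
  set c : ℕ → ℝ := fun n => min 1 (x * (1 + 1 / (n : ℝ)) ^ m n) with hc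
  have hclim : Tendsto c atTop (𝓝 (min 1 (x * Real.exp t))) :=
    tendsto_const_nhds.min ((tendsto_one_add_inv_pow hm).const_mul x)
  have h0 : TendstoScaledL2 (fun n κ => Y n κ - n * c n) 0 := by
    have hlim : Tendsto (fun n : ℕ => Real.exp 2 *
        (𝔼 κ : Fin n → Fin n, (X n κ / n - x) ^ 2 + 1 / n)) atTop (𝓝 0) := by
      simpa using (h.add tendsto_one_div_atTop_nhds_zero_nat).const_mul (Real.exp 2)
    refine tendsto_of_tendsto_of_tendsto_of_le_of_le' tendsto_const_nhds hlim
      (Eventually.of_forall fun n => expect_sq_nonneg _) ?_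
    filter_upwards [hY, eventually_gt_atTop 0] with n hn hn0
    obtain ⟨hmn, hn⟩ := hn
    have hn' : (0 : ℝ) < n := by exact_mod_cast hn0
    have hmin : min (n : ℝ) (n * x * (1 + 1 / n) ^ m n) = n * c n := by
      rw [hc, mul_min_of_nonneg _ _ hn'.le, mul_one, mul_assoc]
    rw [hmin] at hn
    have e1 : ∀ κ : Fin n → Fin n, ((Y n κ - n * c n) / n - 0) ^ 2 =
        (1 / (n : ℝ) ^ 2) * (Y n κ - n * c n) ^ 2 := by
      intro κ; field_simp; ring
    have e2 : ∀ κ : Fin n → Fin n, (X n κ - n * x) ^ 2 = (n : ℝ) ^ 2 * (X n κ / n - x) ^ 2 := by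
      intro κ; field_simp
    simp only [e1, e2] at hn ⊢
    rw [← Finset.mul_expect] at hn ⊢
    have hmn' : (m n : ℝ) ≤ n := by exact_mod_cast hmn
    have hE : 0 ≤ 𝔼 κ : Fin n → Fin n, (X n κ / n - x) ^ 2 := expect_sq_nonneg _
    calc _ ≤ 1 / (n : ℝ) ^ 2 * (Real.exp 2 *
          ((n : ℝ) ^ 2 * 𝔼 κ : Fin n → Fin n, (X n κ / n - x) ^ 2 + n)) := by
          refine mul_le_mul_of_nonneg_left (hn.trans ?_) (by positivity)
          refine mul_le_mul (one_add_inv_pow_le hn0 hmn) (by linarith) ?_ (Real.exp_pos _).le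
          positivity
      _ = _ := by field_simp
  have h1 := h0.affine (X' := Y) (s := 1) (by simp) (fun n => n * c n)
    (e := min 1 (x * Real.exp t)) ?_ (Eventually.of_forall fun n κ => by ring)
  · simpa using h1
  · refine hclim.congr' ?_
    filter_upwards [eventually_gt_atTop 0] with n hn
    have hn' : (n : ℝ) ≠ 0 := by exact_mod_cast hn.ne'
    field_simp

theorem tendsto_natCast_div_self : Tendsto (fun n : ℕ => (n : ℝ) / n) atTop (𝓝 1) := by
  refine tendsto_const_nhds.congr' ?_
  filter_upwards [eventually_gt_atTop 0] with n hn
  have hn' : (n : ℝ) ≠ 0 := by exact_mod_cast hn.ne'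
  field_simp

theorem TendstoScaledL2.runSteps_left {q : ∀ n : ℕ, (Fin n → Fin n) → ℕ} {x t : ℝ}
    (h : TendstoScaledL2 (fun n κ => q n κ) x) (hx : x ∈ Icc (0 : ℝ) 1) {a m : ℕ → ℕ}
    (hm : Tendsto (fun n : ℕ => (m n : ℝ) / n) atTop (𝓝 t))
    (hq : ∀ᶠ n : ℕ in atTop, a n + m n ≤ n ∧ (∀ κ, q n κ < n) ∧
      ∀ κ (i : Fin n), a n ≤ i → ∀ k, q n (Function.update κ i k) = q n κ) :
    TendstoScaledL2 (fun n κ => runSteps stepLeft κ (a n) (q n κ) (m n))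
      (1 - min 1 ((1 - x) * Real.exp t)) := by
  have h1 := h.affine (X' := fun n κ => (n : ℝ) - q n κ) (s := -1) (by simp) (fun n => (n : ℝ))
    tendsto_natCast_div_self (Eventually.of_forall fun n κ => by ring)
  rw [show -1 * x + 1 = 1 - x by ring] at h1
  have h2 : TendstoScaledL2
      (fun n κ => (n : ℝ) - runSteps stepLeft κ (a n) (q n κ) (m n))
      (min 1 ((1 - x) * Real.exp t)) := by
    refine tendstoScaledL2_of_birth h1 hm ?_
    filter_upwards [hq, eventually_gt_atTop 0] with n hn hn0
    have hx1 : 0 ≤ 1 - x := by linarith [hx.2]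
    refine ⟨by omega, ?_⟩
    refine expect_sq_sub_le_of_left hn0 (a n) hn.1 (q n) hn.2.1 hn.2.2 _ (by positivity) ?_
    exact mul_le_of_le_one_right (by positivity) (by linarith [hx.1])
  have h3 := h2.affine (X' := fun n κ => (runSteps stepLeft κ (a n) (q n κ) (m n) : ℝ)) (s := -1)
    (by simp) (fun n => (n : ℝ)) tendsto_natCast_div_self
    (Eventually.of_forall fun n κ => by ring)
  convert h3 using 1
  ring

theorem TendstoScaledL2.add_one {X : ∀ n : ℕ, (Fin n → Fin n) → ℝ} {x : ℝ}
    (h : TendstoScaledL2 X x) : TendstoScaledL2 (fun n κ => X n κ + 1) x := by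
  have := h.affine (X' := fun n κ => X n κ + 1) (s := 1) (by simp) (fun _ => 1)
    tendsto_one_div_atTop_nhds_zero_nat (Eventually.of_forall fun n κ => by ring)
  simpa using this

theorem TendstoScaledL2.runSteps_right {q : ∀ n : ℕ, (Fin n → Fin n) → ℕ} {x t : ℝ}
    (h : TendstoScaledL2 (fun n κ => q n κ) x) (hx : x ∈ Icc (0 : ℝ) 1) {a m : ℕ → ℕ}
    (hm : Tendsto (fun n : ℕ => (m n : ℝ) / n) atTop (𝓝 t))
    (hq : ∀ᶠ n : ℕ in atTop, a n + m n ≤ n ∧ (∀ κ, q n κ < n) ∧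
      ∀ κ (i : Fin n), a n ≤ i → ∀ k, q n (Function.update κ i k) = q n κ) :
    TendstoScaledL2 (fun n κ => (runSteps (stepRight n) κ (a n) (q n κ) (m n) : ℝ) + 1)
      (min 1 (x * Real.exp t)) := by
  refine tendstoScaledL2_of_birth h.add_one hm ?_
  filter_upwards [hq, eventually_gt_atTop 0] with n hn hn0
  refine ⟨by omega, ?_⟩
  have := hx.1
  refine expect_sq_sub_le_of_right hn0 (a n) hn.1 (q n) hn.2.1 hn.2.2 _ (by positivity) ?_
  exact mul_le_of_le_one_right (by positivity) hx.2

theorem tendstoScaledL2_switchedPosition {J c k : ℕ → ℕ} {b s y : ℝ}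
    (hy : y ∈ Icc (0 : ℝ) 1)
    (hJ : Tendsto (fun n : ℕ => (J n : ℝ) / n) atTop (𝓝 b))
    (hc : Tendsto (fun n : ℕ => (c n : ℝ) / n) atTop (𝓝 s))
    (hk : Tendsto (fun n : ℕ => (k n : ℝ) / n) atTop (𝓝 y))
    (h : ∀ᶠ n : ℕ in atTop, J n < c n ∧ c n ≤ n ∧ k n < n) :
    TendstoScaledL2 (fun n κ => (switchedPosition κ (J n) (c n) (k n) : ℝ) + 1)
      (min 1 ((1 - min 1 ((1 - y) * Real.exp (s - b))) * Real.exp (1 - s))) := by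
  have hy1 : 0 ≤ 1 - y := by linarith [hy.2]
  have hm1 : Tendsto (fun n : ℕ => ((c n - (J n + 1) : ℕ) : ℝ) / n) atTop (𝓝 (s - b)) := by
    have := (hc.sub hJ).sub tendsto_one_div_atTop_nhds_zero_nat
    rw [sub_zero] at this
    refine this.congr' ?_
    filter_upwards [h] with n hn
    rw [Nat.cast_sub hn.1]
    push_cast
    ring
  have hm2 : Tendsto (fun n : ℕ => ((n - c n : ℕ) : ℝ) / n) atTop (𝓝 (1 - s)) := by
    refine (tendsto_natCast_div_self.sub hc).congr' ?_
    filter_upwards [h] with n hn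
    rw [Nat.cast_sub hn.2.1]
    ring
  have h1 := (tendstoScaledL2_const (fun n => (k n : ℝ)) hk).runSteps_left (q := fun n _ => k n)
    hy (a := fun n => J n + 1) hm1 (by
      filter_upwards [h] with n hn
      exact ⟨by omega, fun _ => hn.2.2, fun _ _ _ _ => rfl⟩)
  refine h1.runSteps_right (q := fun n κ =>
    runSteps stepLeft κ (J n + 1) (k n) (c n - (J n + 1))) ⟨?_, ?_⟩ (a := c) hm2 ?_
  · linarith [min_le_left 1 ((1 - y) * Real.exp (s - b))]
  · have : 0 ≤ min 1 ((1 - y) * Real.exp (s - b)) := by positivity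
    linarith
  · filter_upwards [h] with n hn
    refine ⟨by omega, fun κ => runSteps_lt _ (fun _ _ h => stepLeft_lt h) κ hn.2.2 _, ?_⟩
    intro κ i hi k'
    exact runSteps_update _ _ _ _ _ _ _ (by omega)

theorem tendstoScaledL2_unprocessed {J c : ℕ → ℕ} {b s : ℝ} (hs : s ∈ Icc (0 : ℝ) 1)
    (hJ : Tendsto (fun n : ℕ => (J n : ℝ) / n) atTop (𝓝 b))
    (hc : Tendsto (fun n : ℕ => (c n : ℝ) / n) atTop (𝓝 s))
    (h : ∀ᶠ n : ℕ in atTop, J n < n ∧ c n < n) :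
    TendstoScaledL2 (fun n κ => runSteps stepLeft κ 0 (c n) (J n))
      (1 - min 1 ((1 - s) * Real.exp b)) := by
  refine (tendstoScaledL2_const (fun n => (c n : ℝ)) hc).runSteps_left (q := fun n _ => c n)
    hs (a := fun _ => 0) hJ ?_
  filter_upwards [h] with n hn
  exact ⟨by omega, fun _ => hn.2, fun _ _ _ _ => rfl⟩

/-! ### Convergence in probability for a given insertion position -/

/-- The probability of an event under uniform insertion positions. -/
noncomputable def uniformProb {n : ℕ} (p : (Fin n → Fin n) → Prop) : ℝ :=
  𝔼 κ, {κ | p κ}.indicator (fun _ => (1 : ℝ)) κ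

theorem uniformProb_nonneg {n : ℕ} (p : (Fin n → Fin n) → Prop) : 0 ≤ uniformProb p :=
  Finset.expect_nonneg fun _ _ => indicator_nonneg (fun _ _ => zero_le_one) _

theorem uniformProb_le_add {n : ℕ} {p p₁ p₂ : (Fin n → Fin n) → Prop}
    (h : ∀ κ, p κ → p₁ κ ∨ p₂ κ) : uniformProb p ≤ uniformProb p₁ + uniformProb p₂ := by
  classical
  unfold uniformProb
  rw [← Finset.expect_add_distrib]
  refine Finset.expect_le_expect fun κ _ => ?_
  have := h κ
  simp only [indicator_apply, mem_ofPred_eq]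
  split_ifs <;> first | tauto | norm_num

theorem TendstoScaledL2.tendsto_uniformProb {X : ∀ n : ℕ, (Fin n → Fin n) → ℝ} {x : ℝ}
    (h : TendstoScaledL2 X x) {δ : ℝ} (hδ : 0 < δ) :
    Tendsto (fun n : ℕ => uniformProb fun κ : Fin n → Fin n => δ ≤ |X n κ / n - x|)
      atTop (𝓝 0) := by
  classical
  have hlim := h.const_mul (1 / δ ^ 2)
  rw [mul_zero] at hlim
  refine tendsto_of_tendsto_of_tendsto_of_le_of_le tendsto_const_nhds hlim
    (fun n => uniformProb_nonneg _) (fun n => ?_)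
  simp only [uniformProb, Finset.mul_expect]
  refine Finset.expect_le_expect fun κ _ => ?_
  rw [indicator_apply]
  split_ifs with hκ
  · have : δ ^ 2 ≤ (X n κ / n - x) ^ 2 := by
      rw [← sq_abs (X n κ / n - x)]
      exact pow_le_pow_left₀ hδ.le hκ 2
    rw [one_div, inv_mul_eq_div, le_div_iff₀ (by positivity)]
    linarith
  · positivity

theorem uniformProb_mono {n : ℕ} {p p₁ : (Fin n → Fin n) → Prop}
    (h : ∀ κ, p κ → p₁ κ) : uniformProb p ≤ uniformProb p₁ :=
  Finset.expect_le_expect fun κ _ =>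
    indicator_le_indicator_of_subset (fun κ hκ => h κ hκ) (fun _ => zero_le_one) κ

theorem TendstoScaledL2.tendsto_uniformProb_le {X : ∀ n : ℕ, (Fin n → Fin n) → ℝ} {x u : ℝ}
    (h : TendstoScaledL2 X x) (hu : u < x) :
    Tendsto (fun n : ℕ => uniformProb fun κ : Fin n → Fin n => X n κ / n ≤ u) atTop (𝓝 0) :=
  tendsto_of_tendsto_of_tendsto_of_le_of_le tendsto_const_nhds
    (h.tendsto_uniformProb (sub_pos.2 hu)) (fun _ => uniformProb_nonneg _)
    (fun n => uniformProb_mono fun κ hκ => by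
      have := neg_abs_le (X n κ / n - x)
      linarith)

theorem TendstoScaledL2.tendsto_uniformProb_ge {X : ∀ n : ℕ, (Fin n → Fin n) → ℝ} {x u : ℝ}
    (h : TendstoScaledL2 X x) (hu : x < u) :
    Tendsto (fun n : ℕ => uniformProb fun κ : Fin n → Fin n => u ≤ X n κ / n) atTop (𝓝 0) :=
  tendsto_of_tendsto_of_tendsto_of_le_of_le tendsto_const_nhds
    (h.tendsto_uniformProb (sub_pos.2 hu)) (fun _ => uniformProb_nonneg _)
    (fun n => uniformProb_mono fun κ hκ => by
      have := le_abs_self (X n κ / n - x)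
      linarith)

/-- The final position (in `{1, …, n}`) of card `J`, given that it is inserted at position `k`. -/
def condPosition {n : ℕ} (κ : Fin n → Fin n) (J k : ℕ) : ℕ :=
  if h : J < n ∧ k < n then
    (deckAt (Function.update κ ⟨J, h.1⟩ ⟨k, h.2⟩) n).symm ⟨J, h.1⟩ + 1 else 0

/-- Neither the switched path nor the position of card `c` at time `J` reads coordinate `J`, so the
insertion position can be fixed to `k` while the others stay uniform. -/
theorem switchedPosition_update {n : ℕ} (κ : Fin n → Fin n) (J i : Fin n) {c : ℕ} (hJc : J < c)
    (k : ℕ) : switchedPosition (Function.update κ J i) J c k = switchedPosition κ J c k := by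
  rw [switchedPosition, switchedPosition, runSteps_update _ _ _ _ _ _ _ (by omega),
    runSteps_update _ _ _ _ _ _ _ (by omega)]

theorem switchedPosition_succ_le_condPosition {n : ℕ} (κ : Fin n → Fin n) {J c k : ℕ} (hJc : J < c)
    (hcn : c ≤ n) (hk : k < n) (h : c < n → k < runSteps stepLeft κ 0 c J) :
    switchedPosition κ J c k + 1 ≤ condPosition κ J k := by
  have hJ : J < n := by omega
  rw [condPosition, dif_pos ⟨hJ, hk⟩]
  have := switchedPosition_le (Function.update κ ⟨J, hJ⟩ ⟨k, hk⟩) ⟨J, hJ⟩ c hJc hcn (by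
    rw [runSteps_update _ _ _ _ _ _ _ (by simp), Function.update_self]
    exact h)
  rw [switchedPosition_update _ _ _ hJc, Function.update_self] at this
  exact Nat.succ_le_succ this

theorem condPosition_le_switchedPosition_succ {n : ℕ} (κ : Fin n → Fin n) {J c k : ℕ} (hJc : J < c)
    (hcn : c ≤ n) (hk : k < n)
    (h : J + 1 < c → c < n ∧ runSteps stepLeft κ 0 c J ≤ k) :
    condPosition κ J k ≤ switchedPosition κ J c k + 1 := by
  have hJ : J < n := by omega
  rw [condPosition, dif_pos ⟨hJ, hk⟩]
  have := le_switchedPosition (Function.update κ ⟨J, hJ⟩ ⟨k, hk⟩) ⟨J, hJ⟩ c hJc hcn (by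
    rw [runSteps_update _ _ _ _ _ _ _ (by simp), Function.update_self]
    exact h)
  rw [switchedPosition_update _ _ _ hJc, Function.update_self] at this
  exact Nat.succ_le_succ this

/-- The limit of the rescaled final position of a card inserted at `y` at time `b`, if it moves
left until time `s` and right from then on. -/
noncomputable def switchedLimit (b y s : ℝ) : ℝ :=
  min 1 ((1 - min 1 ((1 - y) * Real.exp (s - b))) * Real.exp (1 - s))

/-- The time at which a card inserted at `y` at time `b` stops moving left. -/
noncomputable def switchTime (b y : ℝ) : ℝ := 1 - min ((1 - y) * Real.exp (-b)) (1 - b)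

theorem continuous_switchedLimit (b y : ℝ) : Continuous (switchedLimit b y) := by
  unfold switchedLimit
  fun_prop

/-- At the switching time both caps are inactive: otherwise the uncapped expression, which equals `G
b y`, would leave `[0, 1]`. -/
theorem switchedLimit_switchTime {b y : ℝ} (hb : b ∈ Icc (0 : ℝ) 1) (hy : y ∈ Icc (0 : ℝ) 1) :
    switchedLimit b y (switchTime b y) = G b y := by
  have hG := (bijOn_G hb).mapsTo hy
  have key : (1 - (1 - y) * Real.exp (switchTime b y - b)) * Real.exp (1 - switchTime b y) =
      G b y := by
    rw [sub_mul, mul_assoc, ← Real.exp_add, one_mul, G_eq, switchTime]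
    ring_nf
  have h1 : (1 - y) * Real.exp (switchTime b y - b) ≤ 1 := by
    by_contra h
    have := mul_neg_of_neg_of_pos (show 1 - (1 - y) * Real.exp (switchTime b y - b) < 0 by
      linarith) (Real.exp_pos (1 - switchTime b y))
    linarith [hG.1]
  rw [switchedLimit, min_eq_right h1, key, min_eq_right hG.2]

theorem tendsto_floor_mul_div {s : ℝ} (hs : 0 ≤ s) :
    Tendsto (fun n : ℕ => (⌊s * (n : ℝ)⌋₊ : ℝ) / n) atTop (𝓝 s) :=
  (tendsto_nat_floor_mul_div_atTop hs).comp tendsto_natCast_atTop_atTop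

theorem eventually_lt_of_tendsto_div {u v : ℕ → ℕ} {x y : ℝ}
    (hu : Tendsto (fun n : ℕ => (u n : ℝ) / n) atTop (𝓝 x))
    (hv : Tendsto (fun n : ℕ => (v n : ℝ) / n) atTop (𝓝 y)) (h : x < y) :
    ∀ᶠ n in atTop, u n < v n := by
  filter_upwards [hu.eventually_lt hv h, eventually_gt_atTop 0] with n hn hn0
  have hn' : (0 : ℝ) < n := by exact_mod_cast hn0
  rw [div_lt_div_iff_of_pos_right hn'] at hn
  exact_mod_cast hn

theorem tendsto_uniformProb_condPosition_le {b y : ℝ} (hb : b ∈ Icc (0 : ℝ) 1)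
    (hy : y ∈ Ioo (0 : ℝ) 1) {J k : ℕ → ℕ}
    (hJ : Tendsto (fun n : ℕ => (J n : ℝ) / n) atTop (𝓝 b))
    (hk : Tendsto (fun n : ℕ => (k n : ℝ) / n) atTop (𝓝 y))
    (h : ∀ᶠ n : ℕ in atTop, J n < n ∧ k n < n) {u : ℝ} (hu : u < G b y) :
    Tendsto (fun n : ℕ => uniformProb fun κ : Fin n → Fin n =>
      (condPosition κ (J n) (k n) : ℝ) / n ≤ u) atTop (𝓝 0) := by
  have hy' : y ∈ Icc (0 : ℝ) 1 := Ioo_subset_Icc_self hy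
  have hmono : ∀ {m p : ℕ} {v : ℝ}, m ≤ p → ∀ n : ℕ, (p : ℝ) / n ≤ v → (m : ℝ) / n ≤ v := by
    intro m p v hmp n hp
    exact (div_le_div_of_nonneg_right (by exact_mod_cast hmp) (by positivity)).trans hp
  -- For `b = 1` the switching time is `1`, leaving no room for a later switch; `c = n` then gives
  -- an unconditional bound. Otherwise `s` is taken slightly after the switching time.
  rcases hb.2.eq_or_lt with hb1 | hb1
  · have hlim := tendstoScaledL2_switchedPosition (c := fun n => n) hy' hJ
      tendsto_natCast_div_self hk (by filter_upwards [h] with n hn using ⟨hn.1, le_rfl, hn.2⟩)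
    have hs : switchTime b y = 1 := by
      rw [switchTime, hb1, min_eq_right]
      · ring
      · rw [sub_self]
        exact mul_nonneg (by linarith [hy.2]) (Real.exp_pos _).le
    have hval := switchedLimit_switchTime hb hy'
    rw [hs, switchedLimit] at hval
    rw [hval] at hlim
    refine tendsto_of_tendsto_of_tendsto_of_le_of_le' tendsto_const_nhds
      (hlim.tendsto_uniformProb_le hu) (Eventually.of_forall fun _ => uniformProb_nonneg _) ?_
    filter_upwards [h] with n hn
    refine uniformProb_mono fun κ hκ => ?_
    exact_mod_cast hmono
      (switchedPosition_succ_le_condPosition κ hn.1 le_rfl hn.2 (fun h => absurd h (lt_irrefl _)))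
      n hκ
  · have hs1 : switchTime b y < 1 := by
      rw [switchTime, sub_lt_self_iff]
      exact lt_min (mul_pos (by linarith [hy.2]) (Real.exp_pos _)) (by linarith)
    have hev : ∀ᶠ s in 𝓝[>] switchTime b y, u < switchedLimit b y s :=
      nhdsWithin_le_nhds ((continuous_switchedLimit b y).tendsto _ |>.eventually_const_lt
        (by rwa [switchedLimit_switchTime hb hy']))
    obtain ⟨s, hus, hs⟩ := (hev.and (Ioo_mem_nhdsGT hs1)).exists
    have hbs : b < s := by
      refine lt_of_le_of_lt ?_ hs.1
      rw [switchTime]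
      linarith [min_le_right ((1 - y) * Real.exp (-b)) (1 - b)]
    have hs0 : 0 ≤ s := hb.1.trans hbs.le
    have hc := tendsto_floor_mul_div hs0
    have hJc := eventually_lt_of_tendsto_div hJ hc hbs
    have hcn := eventually_lt_of_tendsto_div (v := fun n => n) hc tendsto_natCast_div_self hs.2
    have hlim := tendstoScaledL2_switchedPosition hy' hJ hc hk (by
      filter_upwards [h, hJc, hcn] with n h1 h2 h3 using ⟨h2, h3.le, h1.2⟩)
    have hY := (tendstoScaledL2_unprocessed ⟨hs0, hs.2.le⟩ hJ hc (by
      filter_upwards [h, hcn] with n h1 h3 using ⟨h1.1, h3⟩)).affine (s := 1) (by simp)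
      (X' := fun n κ => (runSteps stepLeft κ 0 ⌊s * (n : ℝ)⌋₊ (J n) : ℝ) - k n)
      (fun n => -(k n : ℝ)) (e := -y) (by simpa only [neg_div] using hk.neg)
      (Eventually.of_forall fun n κ => by ring)
    -- At time `J` the card `⌊sn⌋` is typically beyond `y`, since `s > 1 - (1 - y)e^{-b}`. The
    -- exceptional event has vanishing probability.
    have hpos : 0 < 1 * (1 - min 1 ((1 - s) * Real.exp b)) + -y := by
      have h1 : (1 - s) * Real.exp b < 1 - y := by
        rcases lt_or_ge ((1 - y) * Real.exp (-b)) (1 - b) with hlt | hge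
        · have h2 := hs.1
          rw [switchTime, min_eq_left hlt.le] at h2
          have h3 := mul_lt_mul_of_pos_right (show 1 - s < (1 - y) * Real.exp (-b) by linarith)
            (Real.exp_pos b)
          rwa [mul_assoc, ← Real.exp_add, neg_add_cancel, Real.exp_zero, mul_one] at h3
        · have h3 := mul_lt_mul_of_pos_right (show 1 - s < (1 - y) * Real.exp (-b) by linarith)
            (Real.exp_pos b)
          rwa [mul_assoc, ← Real.exp_add, neg_add_cancel, Real.exp_zero, mul_one] at h3
      linarith [min_le_right 1 ((1 - s) * Real.exp b)]
    have hsum := (hlim.tendsto_uniformProb_le hus).add (hY.tendsto_uniformProb_le hpos)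
    rw [add_zero] at hsum
    refine tendsto_of_tendsto_of_tendsto_of_le_of_le' tendsto_const_nhds hsum
      (Eventually.of_forall fun _ => uniformProb_nonneg _) ?_
    filter_upwards [h, hJc, hcn] with n h1 h2 h3
    refine uniformProb_le_add fun κ hκ => ?_
    rcases le_or_gt (runSteps stepLeft κ 0 ⌊s * (n : ℝ)⌋₊ (J n)) (k n) with hle | hlt
    · right
      refine div_nonpos_of_nonpos_of_nonneg ?_ (by positivity)
      rw [sub_nonpos]
      exact_mod_cast hle
    · left
      exact_mod_cast hmono
        (switchedPosition_succ_le_condPosition κ h2 h3.le h1.2 (fun _ => hlt)) n hκ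

theorem tendsto_uniformProb_condPosition_ge {b y : ℝ} (hb : b ∈ Icc (0 : ℝ) 1)
    (hy : y ∈ Ioo (0 : ℝ) 1) {J k : ℕ → ℕ}
    (hJ : Tendsto (fun n : ℕ => (J n : ℝ) / n) atTop (𝓝 b))
    (hk : Tendsto (fun n : ℕ => (k n : ℝ) / n) atTop (𝓝 y))
    (h : ∀ᶠ n : ℕ in atTop, J n < n ∧ k n < n) {u : ℝ} (hu : G b y < u) :
    Tendsto (fun n : ℕ => uniformProb fun κ : Fin n → Fin n =>
      u ≤ (condPosition κ (J n) (k n) : ℝ) / n) atTop (𝓝 0) := by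
  have hy' : y ∈ Icc (0 : ℝ) 1 := Ioo_subset_Icc_self hy
  have hmono : ∀ {m p : ℕ} {v : ℝ}, m ≤ p → ∀ n : ℕ, v ≤ (m : ℝ) / n → v ≤ (p : ℝ) / n := by
    intro m p v hmp n hp
    exact hp.trans (div_le_div_of_nonneg_right (by exact_mod_cast hmp) (by positivity))
  have hyb : 0 < (1 - y) * Real.exp (-b) := mul_pos (by linarith [hy.2]) (Real.exp_pos _)
  -- If the switching time is `b`, no earlier switch is available and `c = J + 1` is used. Otherwise
  -- `s` is taken slightly before the switching time.
  rcases le_or_gt (1 - b) ((1 - y) * Real.exp (-b)) with hge | hlt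
  · have hs : switchTime b y = b := by
      rw [switchTime, min_eq_right hge]
      ring
    have hc : Tendsto (fun n : ℕ => ((J n + 1 : ℕ) : ℝ) / n) atTop (𝓝 b) := by
      have := hJ.add tendsto_one_div_atTop_nhds_zero_nat
      rw [add_zero] at this
      refine this.congr fun n => ?_
      push_cast
      ring
    have hlim := tendstoScaledL2_switchedPosition (c := fun n => J n + 1) hy' hJ hc hk (by
      filter_upwards [h] with n hn using ⟨by omega, by omega, hn.2⟩)
    have hval := switchedLimit_switchTime hb hy'
    rw [hs, switchedLimit] at hval
    rw [hval] at hlim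
    refine tendsto_of_tendsto_of_tendsto_of_le_of_le' tendsto_const_nhds
      (hlim.tendsto_uniformProb_ge hu) (Eventually.of_forall fun _ => uniformProb_nonneg _) ?_
    filter_upwards [h] with n hn
    refine uniformProb_mono fun κ hκ => ?_
    exact_mod_cast hmono (condPosition_le_switchedPosition_succ κ (Nat.lt_succ_self _) hn.1 hn.2
      (fun h => absurd h (lt_irrefl _)))
      n hκ
  · have hst : switchTime b y = 1 - (1 - y) * Real.exp (-b) := by
      rw [switchTime, min_eq_left hlt.le]
    have hbt : b < switchTime b y := by rw [hst]; linarith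
    have hev : ∀ᶠ s in 𝓝[<] switchTime b y, switchedLimit b y s < u :=
      nhdsWithin_le_nhds ((continuous_switchedLimit b y).tendsto _ |>.eventually_lt_const
        (by rwa [switchedLimit_switchTime hb hy']))
    obtain ⟨s, hus, hs⟩ := (hev.and (Ioo_mem_nhdsLT hbt)).exists
    have hs0 : 0 ≤ s := hb.1.trans hs.1.le
    have hs1 : s < 1 := by
      have := hs.2
      rw [hst] at this
      linarith
    have hc := tendsto_floor_mul_div hs0
    have hJc := eventually_lt_of_tendsto_div hJ hc hs.1
    have hcn := eventually_lt_of_tendsto_div (v := fun n => n) hc tendsto_natCast_div_self hs1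
    have hlim := tendstoScaledL2_switchedPosition hy' hJ hc hk (by
      filter_upwards [h, hJc, hcn] with n h1 h2 h3 using ⟨h2, h3.le, h1.2⟩)
    have hY := (tendstoScaledL2_unprocessed ⟨hs0, hs1.le⟩ hJ hc (by
      filter_upwards [h, hcn] with n h1 h3 using ⟨h1.1, h3⟩)).affine (s := 1) (by simp)
      (X' := fun n κ => (runSteps stepLeft κ 0 ⌊s * (n : ℝ)⌋₊ (J n) : ℝ) - k n)
      (fun n => -(k n : ℝ)) (e := -y) (by simpa only [neg_div] using hk.neg)
      (Eventually.of_forall fun n κ => by ring)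
    have hneg : 1 * (1 - min 1 ((1 - s) * Real.exp b)) + -y < 0 := by
      have h2 := hs.2
      rw [hst] at h2
      have h3 := mul_lt_mul_of_pos_right (show (1 - y) * Real.exp (-b) < 1 - s by linarith)
        (Real.exp_pos b)
      rw [mul_assoc, ← Real.exp_add, neg_add_cancel, Real.exp_zero, mul_one] at h3
      -- Here `y > 0` is needed: card `⌊sn⌋` may already be at the left end, where the cap is
      -- attained.
      have := lt_min (show 1 - y < 1 by linarith [hy.1]) h3
      linarith
    have hsum := (hlim.tendsto_uniformProb_ge hus).add (hY.tendsto_uniformProb_ge hneg)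
    rw [add_zero] at hsum
    refine tendsto_of_tendsto_of_tendsto_of_le_of_le' tendsto_const_nhds hsum
      (Eventually.of_forall fun _ => uniformProb_nonneg _) ?_
    filter_upwards [h, hJc, hcn] with n h1 h2 h3
    refine uniformProb_le_add fun κ hκ => ?_
    rcases le_or_gt (runSteps stepLeft κ 0 ⌊s * (n : ℝ)⌋₊ (J n)) (k n) with hle | hlt
    · left
      exact_mod_cast hmono
        (condPosition_le_switchedPosition_succ κ h2 h3.le h1.2 (fun _ => ⟨h3, hle⟩)) n hκ
    · right
      refine div_nonneg ?_ (by positivity)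
      rw [sub_nonneg]
      exact_mod_cast hlt.le

/-! ### Averaging over the insertion position; weak convergence -/

/-- For `y` uniform on `[0, 1]`, `⌊yn⌋` is uniform on `{0, …, n - 1}`. This puts the insertion
positions for all `n` on one space, so that `y` can be held fixed as `n` grows. -/
theorem intervalIntegral_floor_mul {n : ℕ} (hn : 0 < n) (g : ℕ → ℝ) :
    ∫ y in (0 : ℝ)..1, g ⌊y * (n : ℝ)⌋₊ = (∑ k ∈ Finset.range n, g k) / n := by
  have hn' : (n : ℝ) ≠ 0 := by exact_mod_cast hn.ne'
  have hpiece : ∀ k : ℕ, EqOn (fun u : ℝ => g ⌊u⌋₊) (fun _ => g k) (Ioo (k : ℝ) (k + 1)) := by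
    intro k u hu
    have : ⌊u⌋₊ = k := by
      rw [Nat.floor_eq_iff (k.cast_nonneg.trans hu.1.le)]
      exact ⟨hu.1.le, hu.2⟩
    simp only [this]
  have hle : ∀ k : ℕ, (k : ℝ) ≤ k + 1 := fun k => by linarith
  have hint : ∀ k < n,
      IntervalIntegrable (fun u : ℝ => g ⌊u⌋₊) volume (k : ℝ) ((k + 1 : ℕ) : ℝ) := by
    intro k _
    push_cast
    rw [intervalIntegrable_iff_integrableOn_Ioo_of_le (hle k)]
    exact (integrableOn_const (by simp)).congr_fun (hpiece k).symm measurableSet_Ioo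
  have hval : ∀ k : ℕ, ∫ u in (k : ℝ)..((k + 1 : ℕ) : ℝ), g ⌊u⌋₊ = g k := by
    intro k
    push_cast
    rw [intervalIntegral.integral_of_le (hle k), integral_Ioc_eq_integral_Ioo,
      setIntegral_congr_fun measurableSet_Ioo (hpiece k)]
    simp
  rw [intervalIntegral.integral_comp_mul_right (fun u => g ⌊u⌋₊) hn', zero_mul, one_mul]
  have := intervalIntegral.sum_integral_adjacent_intervals (a := fun k : ℕ => (k : ℝ)) hint
  rw [Nat.cast_zero] at this
  rw [← this, Finset.sum_congr rfl (fun k _ => hval k), smul_eq_mul, div_eq_inv_mul]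

theorem sum_toReal_uniformOfFintype_smul {n : ℕ} [Nonempty (Fin n → Fin n)]
    (g : (Fin n → Fin n) → ℝ) :
    ∑ κ, (PMF.uniformOfFintype (Fin n → Fin n) κ).toReal • g κ = 𝔼 κ, g κ := by
  simp only [PMF.uniformOfFintype_apply, ENNReal.toReal_inv, ENNReal.toReal_natCast, smul_eq_mul]
  rw [← Finset.mul_sum, Fintype.expect_eq_sum_div_card, div_eq_inv_mul]

theorem integral_rescaledPositionLaw (n j : ℕ) (φ : ℝ → ℝ) (hφ : Continuous φ) :
    ∫ x, φ x ∂(rescaledPositionLaw n j : Measure ℝ) =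
      𝔼 κ : Fin n → Fin n, φ ((cardPosition (deckAt κ n) j : ℝ) / n) := by
  have : Nonempty (Fin n → Fin n) := nonempty_fin_fun n
  have hmeas : Measurable (fun κ : Fin n → Fin n => (cardPosition (deckAt κ n) j : ℝ) / n) :=
    measurable_of_finite _
  have hlaw : (rescaledPositionLaw n j : Measure ℝ) =
      (PMF.uniformOfFintype (Fin n → Fin n)).toMeasure.map
        (fun κ => (cardPosition (deckAt κ n) j : ℝ) / n) := by
    rw [PMF.toMeasure_map _ _ hmeas]
    change PMF.toMeasure (PMF.map _ (shuffleLaw 1)) = _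
    rw [shuffleLaw, PMF.map_comp]
    congr 2
    funext κ
    simp [shuffleOutcome_one]
  rw [hlaw, integral_map hmeas.aemeasurable hφ.aestronglyMeasurable, PMF.integral_eq_sum,
    sum_toReal_uniformOfFintype_smul]

theorem expect_cardPosition_eq_integral {n j : ℕ} (hj : 1 ≤ j) (hjn : j ≤ n) (φ : ℝ → ℝ) :
    𝔼 κ : Fin n → Fin n, φ ((cardPosition (deckAt κ n) j : ℝ) / n) =
      ∫ y in Icc (0 : ℝ) 1,
        𝔼 κ : Fin n → Fin n, φ ((condPosition κ (j - 1) ⌊y * (n : ℝ)⌋₊ : ℝ) / n) := by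
  have hJ : j - 1 < n := by omega
  rw [integral_Icc_eq_integral_Ioc, ← intervalIntegral.integral_of_le zero_le_one,
    intervalIntegral_floor_mul (by omega)
      (fun k => 𝔼 κ : Fin n → Fin n, φ ((condPosition κ (j - 1) k : ℝ) / n)),
    expect_update ⟨j - 1, hJ⟩, Finset.expect_comm, Fintype.expect_eq_sum_div_card, Fintype.card_fin,
    ← Fin.sum_univ_eq_sum_range
      (fun k => 𝔼 κ : Fin n → Fin n, φ ((condPosition κ (j - 1) k : ℝ) / n))]
  congr 1
  refine Finset.sum_congr rfl fun k _ => Finset.expect_congr rfl fun κ _ => ?_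
  rw [condPosition, dif_pos ⟨hJ, k.isLt⟩, cardPosition, dif_pos ⟨hj, hjn⟩]

theorem tendsto_expect_of_tendsto_uniformProb (X : ∀ n : ℕ, (Fin n → Fin n) → ℝ) (g : ℝ)
    (hle : ∀ u < g, Tendsto (fun n : ℕ => uniformProb fun κ : Fin n → Fin n => X n κ ≤ u)
      atTop (𝓝 0))
    (hge : ∀ u > g, Tendsto (fun n : ℕ => uniformProb fun κ : Fin n → Fin n => u ≤ X n κ)
      atTop (𝓝 0))
    (φ : ℝ →ᵇ ℝ) :
    Tendsto (fun n : ℕ => 𝔼 κ : Fin n → Fin n, φ (X n κ)) atTop (𝓝 (φ g)) := by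
  classical
  rw [Metric.tendsto_atTop']
  intro ε hε
  obtain ⟨δ, hδ, hφ⟩ := Metric.continuous_iff.1 φ.continuous g (ε / 2) (by linarith)
  have hlim := ((hle (g - δ) (by linarith)).add (hge (g + δ) (by linarith))).const_mul (2 * ‖φ‖)
  rw [add_zero, mul_zero] at hlim
  obtain ⟨N, hN⟩ := eventually_atTop.1 (hlim.eventually_lt_const (show 0 < ε / 2 by linarith))
  refine ⟨N, fun n hn => ?_⟩
  have hpt : ∀ κ : Fin n → Fin n, |φ (X n κ) - φ g| ≤ ε / 2 + 2 * ‖φ‖ *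
      ({κ | X n κ ≤ g - δ}.indicator (fun _ => (1 : ℝ)) κ +
        {κ | g + δ ≤ X n κ}.indicator (fun _ => (1 : ℝ)) κ) := by
    intro κ
    have hnorm := norm_nonneg φ
    have hbd : |φ (X n κ) - φ g| ≤ 2 * ‖φ‖ := φ.dist_le_two_norm _ _
    by_cases h1 : X n κ ≤ g - δ
    · rw [indicator_of_mem (show κ ∈ {κ | X n κ ≤ g - δ} from h1)]
      have : 0 ≤ {κ | g + δ ≤ X n κ}.indicator (fun _ => (1 : ℝ)) κ :=
        indicator_nonneg (fun _ _ => zero_le_one) _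
      nlinarith
    · by_cases h2 : g + δ ≤ X n κ
      · rw [indicator_of_mem (show κ ∈ {κ | g + δ ≤ X n κ} from h2)]
        have : 0 ≤ {κ | X n κ ≤ g - δ}.indicator (fun _ => (1 : ℝ)) κ :=
          indicator_nonneg (fun _ _ => zero_le_one) _
        nlinarith
      · rw [indicator_of_notMem (show κ ∉ {κ | X n κ ≤ g - δ} from h1),
          indicator_of_notMem (show κ ∉ {κ | g + δ ≤ X n κ} from h2)]
        have := hφ (X n κ) (by rw [Real.dist_eq, abs_lt]; constructor <;> linarith)
        rw [Real.dist_eq] at this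
        linarith
  have hexp : (𝔼 κ : Fin n → Fin n, φ (X n κ)) - φ g =
      𝔼 κ : Fin n → Fin n, (φ (X n κ) - φ g) := by
    rw [Finset.expect_sub_distrib, expect_fun_const]
  rw [Real.dist_eq, hexp]
  have hN' := hN n hn.le
  calc |𝔼 κ : Fin n → Fin n, (φ (X n κ) - φ g)|
      ≤ 𝔼 κ : Fin n → Fin n, |φ (X n κ) - φ g| := Finset.abs_expect_le _ _
    _ ≤ _ := Finset.expect_le_expect fun κ _ => hpt κ
    _ = ε / 2 + 2 * ‖φ‖ * (uniformProb (fun κ : Fin n → Fin n => X n κ ≤ g - δ) +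
          uniformProb (fun κ : Fin n → Fin n => g + δ ≤ X n κ)) := by
        rw [Finset.expect_add_distrib, expect_fun_const, ← Finset.mul_expect,
          Finset.expect_add_distrib]
        rfl
    _ < ε := by linarith

theorem tendsto_rescaledPositionLaw {b : ℝ} (hb : b ∈ Icc (0 : ℝ) 1) {j : ℕ → ℕ}
    (hj : ∀ n, 1 ≤ n → 1 ≤ j n ∧ j n ≤ n)
    (hlim : Tendsto (fun n : ℕ => (j n : ℝ) / n) atTop (𝓝 b)) :
    Tendsto (fun n => rescaledPositionLaw n (j n)) atTop (𝓝 (limitLaw b)) := by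
  rw [ProbabilityMeasure.tendsto_iff_forall_integral_tendsto]
  intro φ
  rw [integral_limitLaw b φ φ.continuous]
  have hJ : Tendsto (fun n : ℕ => ((j n - 1 : ℕ) : ℝ) / n) atTop (𝓝 b) := by
    have := hlim.sub tendsto_one_div_atTop_nhds_zero_nat
    rw [sub_zero] at this
    refine this.congr' ?_
    filter_upwards [eventually_ge_atTop 1] with n hn
    rw [Nat.cast_sub (hj n hn).1]
    push_cast
    ring
  have hdct : Tendsto (fun n : ℕ => ∫ y in Icc (0 : ℝ) 1,
      𝔼 κ : Fin n → Fin n, φ ((condPosition κ (j n - 1) ⌊y * (n : ℝ)⌋₊ : ℝ) / n)) atTop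
      (𝓝 (∫ y in Icc (0 : ℝ) 1, φ (G b y))) := by
    refine tendsto_integral_of_dominated_convergence (fun _ => ‖φ‖) (fun n => ?_) ?_
      (fun n => Eventually.of_forall fun y => ?_) ?_
    · have : Measurable (fun k : ℕ =>
          𝔼 κ : Fin n → Fin n, φ ((condPosition κ (j n - 1) k : ℝ) / n)) := measurable_from_top
      exact (this.comp (Nat.measurable_floor.comp (measurable_id.mul_const _))).aestronglyMeasurable
    · exact integrable_const _
    · rw [Real.norm_eq_abs]
      refine (Finset.abs_expect_le _ _).trans ?_
      rw [← expect_fun_const (n := n) ‖φ‖]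
      exact Finset.expect_le_expect fun κ _ => φ.norm_coe_le_norm _
    -- The endpoints are null, and the pointwise limit is available only for `0 < y < 1`.
    · rw [← restrict_Ioo_eq_restrict_Icc]
      refine (ae_restrict_mem measurableSet_Ioo).mono fun y hy => ?_
      have hk := tendsto_floor_mul_div hy.1.le
      have hkn := eventually_lt_of_tendsto_div (v := fun n => n) hk tendsto_natCast_div_self hy.2
      have hev : ∀ᶠ n : ℕ in atTop, j n - 1 < n ∧ ⌊y * (n : ℝ)⌋₊ < n := by
        filter_upwards [hkn, eventually_ge_atTop 1] with n h1 h2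
        have := hj n h2
        exact ⟨by omega, h1⟩
      exact tendsto_expect_of_tendsto_uniformProb
        (fun n κ => (condPosition κ (j n - 1) ⌊y * (n : ℝ)⌋₊ : ℝ) / n) (G b y)
        (fun u hu => tendsto_uniformProb_condPosition_le hb hy hJ hk hev hu)
        (fun u hu => tendsto_uniformProb_condPosition_ge hb hy hJ hk hev hu) φ
  refine hdct.congr' ?_
  filter_upwards [eventually_ge_atTop 1] with n hn
  rw [integral_rescaledPositionLaw n (j n) φ φ.continuous,
    expect_cardPosition_eq_integral (hj n hn).1 (hj n hn).2]

theorem positionProb_eq {n : ℕ} (hn : 0 < n) (j : ℕ) (x : ℝ) :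
    positionProb n j (x * n) = (rescaledPositionLaw n j : Measure ℝ).real (Iic x) := by
  have hn' : (0 : ℝ) < n := by exact_mod_cast hn
  rw [positionProb, Measure.real]
  change _ = (PMF.toMeasure (PMF.map _ (shuffleLaw 1)) (Iic x)).toReal
  rw [PMF.toMeasure_apply_eq_toOuterMeasure, PMF.toOuterMeasure_map_apply]
  congr 3
  ext σ
  change _ ↔ _ ≤ x
  rw [div_le_iff₀ hn']

/-- The limit law has no atoms because `G b` is injective, so weak convergence gives convergence of
the distribution functions at every point. -/
theorem tendsto_positionProb {b : ℝ} (hb : 0 ≤ b) {j : ℕ → ℕ}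
    (h : Tendsto (fun n => rescaledPositionLaw n (j n)) atTop (𝓝 (limitLaw b))) (x : ℝ) :
    Tendsto (fun n => positionProb n (j n) (x * n)) atTop
      (𝓝 (ProbabilityTheory.cdf (limitLaw b : Measure ℝ) x)) := by
  rw [ProbabilityTheory.cdf_eq_real]
  have hm := ProbabilityMeasure.tendsto_measure_of_null_frontier_of_tendsto' h (E := Iic x)
    (by rw [frontier_Iic]; exact limitLaw_singleton hb x)
  refine ((ENNReal.tendsto_toReal (measure_ne_top _ _)).comp hm).congr' ?_
  filter_upwards [eventually_gt_atTop 0] with n hn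
  rw [positionProb_eq hn]
  rfl

theorem theorem4 (b : ℝ) (hb : b ∈ Set.Icc (0 : ℝ) 1) :
    Set.BijOn (G b) (Set.Icc 0 1) (Set.Icc 0 1) ∧
    ∃ μ : ProbabilityMeasure ℝ,
      Set.InvOn (ProbabilityTheory.cdf (μ : Measure ℝ)) (G b) (Set.Icc 0 1) (Set.Icc 0 1) ∧
      ∀ (bseq : ℕ → ℝ) (j : ℕ → ℕ),
        (∀ n, 1 ≤ n → 1 ≤ j n ∧ j n ≤ n ∧ (j n : ℝ) = bseq n * n) →
        Tendsto bseq atTop (𝓝 b) →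
          Tendsto (fun n => rescaledPositionLaw n (j n)) atTop (𝓝 μ) ∧
          ∀ x ∈ Set.Icc (0 : ℝ) 1,
            Tendsto (fun n => positionProb n (j n) (x * n)) atTop
              (𝓝 (ProbabilityTheory.cdf (μ : Measure ℝ) x)) := by
  refine ⟨bijOn_G hb, limitLaw b, invOn_cdf_limitLaw hb, fun bseq j hj hlim => ?_⟩
  have hlim' : Tendsto (fun n : ℕ => (j n : ℝ) / n) atTop (𝓝 b) := by
    refine hlim.congr' ?_
    filter_upwards [eventually_ge_atTop 1] with n hn
    have hn' : (n : ℝ) ≠ 0 := by exact_mod_cast (show n ≠ 0 by omega)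
    rw [(hj n hn).2.2, mul_div_assoc, div_self hn', mul_one]
  have h := tendsto_rescaledPositionLaw hb (fun n hn => ⟨(hj n hn).1, (hj n hn).2.1⟩) hlim'
  exact ⟨h, fun x _ => tendsto_positionProb hb.1 h x⟩
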